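/- **Setting.** Let $d_L,d_P\ge 1$, $\mathcal H_L\cong\mathcal H_{\bar L}\cong\mathbb C^{d_L}$, $\mathcal H_P\cong\mathcal H_{\bar P}\cong\mathbb C^{d_P}$, put $d=d_Ld_P$, and let $\mathcal N$ be a quantum channel (completely positive, trace preserving) on $\mathcal H_P$. The channel fidelity is $$F(\mathcal N,d_L)=\sup_{\mathcal E,\mathcal D}\ \langle\Phi|\,(\mathrm{id}\otimes\mathcal D\circ\mathcal N\circ\mathcal E)(|\Phi\rangle\langle\Phi|)\,|\Phi\rangle ,$$ over all channels $\mathcal E:\mathcal H_L\to\mathcal H_P$ and $\mathcal D:\mathcal H_P\to\mathcal H_L$, where $\Phi$ is the normalized maximally entangled state of two copies of $\mathcal H_L$. Let $C=C_{\mathrm{id}_L\otimes\mathcal N}$ be the normalized (trace one) Choi matrix of $\mathrm{id}_L\otimes\mathcal N$ from $\bar L\bar P$ to $LP$, and $f(\omega)=d_P^2\,\mathrm{tr}[C\omega]$ for $\omega$ on $LP\otimes\bar L\bar P$. Let $\Sigma_{\mathrm{prod}}$ be the convex hull of all $\rho_{LP}\otimes\sigma_{\bar L\bar P}$ with states satisfying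 $\mathrm{tr}_L\rho=\mathbb 1_P/d_P$ and $\mathrm{tr}_{\bar P}\sigma=\mathbb 1_{\bar L}/d_L$. For $n\ge1$ call a state $\rho$ on $LP(\bar L\bar P)^{(1\ldots n)}$ feasible at level $n$ if it is invariant under permutations of the $n$ copies of $\bar L\bar P$, $\mathrm{tr}_L\rho=\frac{\mathbb 1_P}{d_P}\otimes\rho_{(\bar L\bar P)^{(1\ldots n)}}$ and $\mathrm{tr}_{\bar P^{(n)}}\rho_{(\bar L\bar P)^{(1\ldots n)}}=\rho_{(\bar L\bar P)^{(1\ldots n-1)}}\otimes\frac{\mathbb 1_{\bar L}}{d_L}$. Write $\rho_{LP\bar L\bar P}$ for its reduction to $LP$ and the first copy of $\bar L\bar P$, let $\mathrm{SDP}_n^\star$ be the maximum of $f(\rho_{LP\bar L\bar P})$ over all feasible $\rho$, and let $\rho^{\star,n}$ be, for every $n\ge1$, a maximizer. A measurement (POVM) $\mathcal M=(M_z)_{z\in Z}$ on $\bar L\bar P$ with finitely many outcomes is called informationally complete with distortion $c$ if $\|\zeta\|_1\le c\,\|(\mathrm{id}_{LP}\otimes\mathcal M)(\zeta)\|_1$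 for all Hermitian $\zeta$ on $LP\otimes\bar L\bar P$. For $0\le m<n$, measure the copies $2,\dots,m+1$ of $\bar L\bar P$ in $\rho^{\star,n}$ with $\mathcal M^{\otimes m}$, discard the copies $m+2,\dots,n$, let $p(z)$ be the probability of the outcomes $z\in Z^m$, and $\rho^\star_{LP|z}$, $\rho^\star_{\bar L\bar P|z}$ the conditional states on $LP$ and on the first copy of $\bar L\bar P$. Put $$\sigma^{[n,m]}=\sum_{z\in Z^m}p(z)\,\rho^\star_{LP|z}\otimes\rho^\star_{\bar L\bar P|z}.$$ **Theorem (Inner bounds).** (a) Let $\mathcal M$ be informationally complete with distortion $c$. For every $n\ge1$ there is an $m_n$ with $0\le m_n<n$ such that $\sigma^{[n]}:=\sigma^{[n,m_n]}$ lies in $\Sigma_{\mathrm{prod}}$ and $$f(\sigma^{[n]})\ \le\ F(\mathcal N,d_L)\ \le\ \mathrm{SDP}_n^\star\ \le\ f(\sigma^{[n]})+ d_P^2\,\|C\|_\infty\,c\,\sqrt{\frac{2\ln d}{n}} .$$ In particular $0\le F(\mathcal N,d_L)-f(\sigma^{[n]})\le d_P^2\,\|C\|_\infty\,c\,\sqrt{2\ln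 d/n}$, and $f(\sigma^{[n]})\to F(\mathcal N,d_L)$ from below as $n\to\infty$. (b) There is a polynomial $q$ in two variables such that for all $d_L,d_P$ there is an informationally complete measurement on $\bar L\bar P$ for which, for every $\mathcal N$ and every choice of maximizers $\rho^{\star,n}$, suitable $m_n<n$ give $\sigma^{[n]}\in\Sigma_{\mathrm{prod}}$ with $$0\le F(\mathcal N,d_L)-f(\sigma^{[n]})\le \frac{q(d_L,d_P)}{\sqrt n}\qquad\text{for all } n\ge1 .$$ -/

import Mathlib

open Filter Topology
open scoped Kronecker ComplexOrder

namespace AQEC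

noncomputable section

/-! ### States, partial traces, norms -/

/-- A density operator on the Hilbert space `ℂ^a`. -/
def IsState {a : Type} [Fintype a] (ρ : Matrix a a ℂ) : Prop :=
  ρ.PosSemidef ∧ ρ.trace = 1

/-- Partial trace over the first tensor factor. -/
def trFst {a b : Type} [Fintype a] (X : Matrix (a × b) (a × b) ℂ) : Matrix b b ℂ :=
  Matrix.of fun i j => ∑ x, X (x, i) (x, j)

/-- Partial trace over the second tensor factor. -/
def trSnd {a b : Type} [Fintype b] (X : Matrix (a × b) (a × b) ℂ) : Matrix a a ℂ :=
  Matrix.of fun i j => ∑ y, X (i, y) (j, y)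

/-- The maximally mixed state `𝟙 / dim`. -/
def maxMixed (a : Type) [Fintype a] [DecidableEq a] : Matrix a a ℂ :=
  ((Fintype.card a : ℂ)⁻¹) • (1 : Matrix a a ℂ)

/-- The trace norm (Schatten 1-norm): the sum of the singular values, i.e. of the square roots of
the eigenvalues of `Xᴴ X`. -/
def traceNorm {a : Type} [Fintype a] [DecidableEq a] (X : Matrix a a ℂ) : ℝ :=
  ∑ i, Real.sqrt ((Matrix.isHermitian_conjTranspose_mul_self X).eigenvalues i)

/-- The operator norm (Schatten ∞-norm), with respect to the Euclidean norm on `ℂ^a`. -/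
def opNorm {a : Type} [Fintype a] [DecidableEq a] (X : Matrix a a ℂ) : ℝ :=
  ‖Matrix.toEuclideanCLM (n := a) (𝕜 := ℂ) X‖

/-! ### Channels, Choi matrices, channel fidelity -/

/-- The map `id_r ⊗ Φ`. -/
def idTensor (r : Type) {a b : Type} (Φ : Matrix a a ℂ →ₗ[ℂ] Matrix b b ℂ) :
    Matrix (r × a) (r × a) ℂ →ₗ[ℂ] Matrix (r × b) (r × b) ℂ where
  toFun X := Matrix.of fun i j => Φ (Matrix.of fun x y => X (i.1, x) (j.1, y)) i.2 j.2
  map_add' X Y := by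
    ext i j
    exact congrFun (congrFun (Φ.map_add (Matrix.of fun x y => X (i.1, x) (j.1, y))
      (Matrix.of fun x y => Y (i.1, x) (j.1, y))) i.2) j.2
  map_smul' c X := by
    ext i j
    exact congrFun (congrFun
      (Φ.map_smul c (Matrix.of fun x y => X (i.1, x) (j.1, y))) i.2) j.2

/-- A quantum channel: a completely positive and trace preserving linear map. -/
def IsChannel {a b : Type} [Fintype a] [Fintype b]
    (Φ : Matrix a a ℂ →ₗ[ℂ] Matrix b b ℂ) : Prop :=
  (∀ (k : ℕ) (X : Matrix (Fin k × a) (Fin k × a) ℂ),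
      X.PosSemidef → (idTensor (Fin k) Φ X).PosSemidef) ∧
    ∀ X : Matrix a a ℂ, (Φ X).trace = X.trace

/-- The normalized maximally entangled state on `ℂ^a ⊗ ℂ^a`, i.e. the projector onto
`d^{-1/2} ∑ᵢ |i⟩|i⟩`. -/
def maxEntangled (a : Type) [Fintype a] [DecidableEq a] : Matrix (a × a) (a × a) ℂ :=
  Matrix.of fun i j => if i.1 = i.2 ∧ j.1 = j.2 then (Fintype.card a : ℂ)⁻¹ else 0

/-- The normalized Choi matrix `(1/d_a) ∑_{x,x'} Φ(|x⟩⟨x'|) ⊗ |x⟩⟨x'|`, with the output system as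
the first tensor factor and the input system as the second one. -/
def choi {a b : Type} [Fintype a] [DecidableEq a] (Φ : Matrix a a ℂ →ₗ[ℂ] Matrix b b ℂ) :
    Matrix (b × a) (b × a) ℂ :=
  Matrix.of fun i j => (Fintype.card a : ℂ)⁻¹ * Φ (Matrix.single i.2 j.2 1) i.1 j.1

variable {L P Z : Type} [Fintype L] [DecidableEq L] [Fintype P] [DecidableEq P] [Fintype Z]

/-- The fidelity `⟨Φ| (id ⊗ 𝒟∘𝒩∘ℰ)(|Φ⟩⟨Φ|) |Φ⟩` of the maximally entangled state of the logical
system with its image. -/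
def codeFidelity (N : Matrix P P ℂ →ₗ[ℂ] Matrix P P ℂ)
    (E : Matrix L L ℂ →ₗ[ℂ] Matrix P P ℂ) (D : Matrix P P ℂ →ₗ[ℂ] Matrix L L ℂ) : ℝ :=
  ((maxEntangled L * idTensor L (D ∘ₗ N ∘ₗ E) (maxEntangled L)).trace).re

variable (L) in
/-- The channel fidelity `F(𝒩, d_L)`: the supremum over all encoders and decoders. -/
def channelFidelity (N : Matrix P P ℂ →ₗ[ℂ] Matrix P P ℂ) : ℝ :=
  sSup {f : ℝ | ∃ (E : Matrix L L ℂ →ₗ[ℂ] Matrix P P ℂ) (D : Matrix P P ℂ →ₗ[ℂ] Matrix L L ℂ),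
    IsChannel E ∧ IsChannel D ∧ f = codeFidelity N E D}

variable (L) in
/-- The Choi matrix `C_{id_L ⊗ 𝒩}` on `(LP) ⊗ (L̄P̄)`, for `id_L ⊗ 𝒩` from `L̄P̄` to `LP`. -/
def choiIdTensor (N : Matrix P P ℂ →ₗ[ℂ] Matrix P P ℂ) :
    Matrix ((L × P) × (L × P)) ((L × P) × (L × P)) ℂ :=
  choi (idTensor L N)

/-- The objective `d_P² tr[C_{id_L ⊗ 𝒩} ω]`. -/
def objective (N : Matrix P P ℂ →ₗ[ℂ] Matrix P P ℂ)
    (ω : Matrix ((L × P) × (L × P)) ((L × P) × (L × P)) ℂ) : ℝ :=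
  (Fintype.card P : ℝ) ^ 2 * ((choiIdTensor L N * ω).trace).re

/-! ### The feasible set and its extendibility hierarchy -/

variable (L P) in
/-- `Σ_prod(LP : L̄P̄)`: the convex hull of the product states `ρ_{LP} ⊗ σ_{L̄P̄}` with
`tr_L ρ = 𝟙_P / d_P` and `tr_{P̄} σ = 𝟙_{L̄} / d_L`. -/
def SigmaProd : Set (Matrix ((L × P) × (L × P)) ((L × P) × (L × P)) ℂ) :=
  convexHull ℝ {ω | ∃ ρ σ : Matrix (L × P) (L × P) ℂ, IsState ρ ∧ IsState σ ∧
    trFst ρ = maxMixed P ∧ trSnd σ = maxMixed L ∧ ω = ρ ⊗ₖ σ}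

variable (L P) in
/-- Operators on `LP (L̄P̄)^{(1…n)}`; the copies of `L̄P̄` are indexed by `Fin n`. -/
abbrev ExtOp (n : ℕ) : Type :=
  Matrix ((L × P) × (Fin n → L × P)) ((L × P) × (Fin n → L × P)) ℂ

/-- Partial trace over `L` on `LP (L̄P̄)^{(1…n)}`. -/
def trL {n : ℕ} (ρ : ExtOp L P n) : Matrix (P × (Fin n → L × P)) (P × (Fin n → L × P)) ℂ :=
  Matrix.of fun i j => ∑ l, ρ ((l, i.1), i.2) ((l, j.1), j.2)

/-- Partial trace over the last copy of `P̄` on `(L̄P̄)^{(1…k+1)}`. -/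
def trLastP {k : ℕ} (X : Matrix (Fin (k + 1) → L × P) (Fin (k + 1) → L × P) ℂ) :
    Matrix ((Fin k → L × P) × L) ((Fin k → L × P) × L) ℂ :=
  Matrix.of fun i j => ∑ p, X (Fin.snoc (α := fun _ => L × P) i.1 (i.2, p))
    (Fin.snoc (α := fun _ => L × P) j.1 (j.2, p))

/-- Partial trace over the last copy of `L̄P̄` on `(L̄P̄)^{(1…k+1)}`. -/
def trLast {k : ℕ} (X : Matrix (Fin (k + 1) → L × P) (Fin (k + 1) → L × P) ℂ) :
    Matrix (Fin k → L × P) (Fin k → L × P) ℂ :=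
  Matrix.of fun i j => ∑ x, X (Fin.snoc (α := fun _ => L × P) i x)
    (Fin.snoc (α := fun _ => L × P) j x)

/-- The constraints on the extended variable of the hierarchy at level `n = k + 1`. -/
structure IsFeasibleExt {k : ℕ} (ρ : ExtOp L P (k + 1)) : Prop where
  state : IsState ρ
  symm : ∀ π : Equiv.Perm (Fin (k + 1)),
    ρ.submatrix (fun i => (i.1, i.2 ∘ π)) (fun i => (i.1, i.2 ∘ π)) = ρ
  decoder : trL ρ = maxMixed P ⊗ₖ trFst ρ
  encoder : trLastP (trFst ρ) = trLast (trFst ρ) ⊗ₖ maxMixed L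

/-- `tr_{copies 2…n}[(𝟙_{LP} ⊗ 𝟙_{copy 1} ⊗ w₂ ⊗ ⋯ ⊗ wₙ) ρ]`, an operator on `LP L̄P̄`. -/
def contract {k : ℕ} (w : Fin k → Matrix (L × P) (L × P) ℂ) (ρ : ExtOp L P (k + 1)) :
    Matrix ((L × P) × (L × P)) ((L × P) × (L × P)) ℂ :=
  Matrix.of fun i j => ∑ r : Fin k → L × P, ∑ s : Fin k → L × P,
    (∏ t, w t (r t) (s t)) * ρ (i.1, Fin.cons (α := fun _ => L × P) i.2 s)
      (j.1, Fin.cons (α := fun _ => L × P) j.2 r)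

/-- The reduced operator `ρ_{LP L̄P̄}` on `LP` and the first copy of `L̄P̄`. -/
def reduced {k : ℕ} (ρ : ExtOp L P (k + 1)) :
    Matrix ((L × P) × (L × P)) ((L × P) × (L × P)) ℂ :=
  Matrix.of fun i j => ∑ r : Fin k → L × P, ρ (i.1, Fin.cons (α := fun _ => L × P) i.2 r)
    (j.1, Fin.cons (α := fun _ => L × P) j.2 r)

variable (L P) in
/-- `Σ^n_prod(LP : L̄P̄)` with `n = k + 1`. -/
def SigmaProdLevel (k : ℕ) : Set (Matrix ((L × P) × (L × P)) ((L × P) × (L × P)) ℂ) :=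
  {ω | ∃ ρ : ExtOp L P (k + 1), IsFeasibleExt ρ ∧ reduced ρ = ω}

/-- `ρ` is an (extended) optimizer of the level `n = k + 1` of the hierarchy. -/
def IsOptimizer (N : Matrix P P ℂ →ₗ[ℂ] Matrix P P ℂ) {k : ℕ} (ρ : ExtOp L P (k + 1)) : Prop :=
  IsFeasibleExt ρ ∧ ∀ ω ∈ SigmaProdLevel L P k, objective N ω ≤ objective N (reduced ρ)

/-! ### Measurements and rounding -/

/-- A measurement (POVM) with outcomes in the finite set `Z`. -/
def IsMeasurement (M : Z → Matrix (L × P) (L × P) ℂ) : Prop :=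
  (∀ z, (M z).PosSemidef) ∧ ∑ z, M z = 1

/-- The block `tr_{L̄P̄}[(𝟙 ⊗ E) ζ]` of a measured operator which belongs to the effect `E`. -/
def measuredBlock (E : Matrix (L × P) (L × P) ℂ)
    (ζ : Matrix ((L × P) × (L × P)) ((L × P) × (L × P)) ℂ) : Matrix (L × P) (L × P) ℂ :=
  trSnd (((1 : Matrix (L × P) (L × P) ℂ) ⊗ₖ E) * ζ)

/-- Informational completeness of `M` on `L̄P̄` with distortion `c`:
`‖ζ‖₁ ≤ c ‖ℳ(ζ)‖₁` for all Hermitian `ζ` on `LP ⊗ L̄P̄`. As `ℳ(ζ) = ∑_z tr_{L̄P̄}[(𝟙 ⊗ M_z) ζ] ⊗ |z⟩⟨z|`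
is block diagonal, its trace norm is the sum of the trace norms of the blocks. -/
def IsInfoComplete (M : Z → Matrix (L × P) (L × P) ℂ) (c : ℝ) : Prop :=
  ∀ ζ : Matrix ((L × P) × (L × P)) ((L × P) × (L × P)) ℂ, ζ.IsHermitian →
    traceNorm ζ ≤ c * ∑ z, traceNorm (measuredBlock (M z) ζ)

/-- The unnormalized post-measurement operator on `LP L̄P̄` when the copies `2, …, m+1` are measured
with outcomes `z` and the copies after them are discarded. -/
def postMeas (M : Z → Matrix (L × P) (L × P) ℂ) {k : ℕ} (ρ : ExtOp L P (k + 1)) {m : ℕ}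
    (z : Fin m → Z) : Matrix ((L × P) × (L × P)) ((L × P) × (L × P)) ℂ :=
  contract (fun t => if h : t.1 < m then M (z ⟨t.1, h⟩) else 1) ρ

/-- The probability `p(z)` of the outcomes `z`. -/
def prob (M : Z → Matrix (L × P) (L × P) ℂ) {k : ℕ} (ρ : ExtOp L P (k + 1)) {m : ℕ}
    (z : Fin m → Z) : ℝ :=
  ((postMeas M ρ z).trace).re

/-- The conditional state `ρ_{LP | z}` (zero if `p(z) = 0`). -/
def condLP (M : Z → Matrix (L × P) (L × P) ℂ) {k : ℕ} (ρ : ExtOp L P (k + 1)) {m : ℕ}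
    (z : Fin m → Z) : Matrix (L × P) (L × P) ℂ :=
  (prob M ρ z)⁻¹ • trSnd (postMeas M ρ z)

/-- The conditional state `ρ_{L̄P̄ | z}` (zero if `p(z) = 0`). -/
def condBar (M : Z → Matrix (L × P) (L × P) ℂ) {k : ℕ} (ρ : ExtOp L P (k + 1)) {m : ℕ}
    (z : Fin m → Z) : Matrix (L × P) (L × P) ℂ :=
  (prob M ρ z)⁻¹ • trFst (postMeas M ρ z)

/-- The rounded point `∑_z p(z) ρ_{LP | z} ⊗ ρ_{L̄P̄ | z}` obtained by measuring `m` extension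
systems. -/
def rounded (M : Z → Matrix (L × P) (L × P) ℂ) {k : ℕ} (ρ : ExtOp L P (k + 1)) (m : ℕ) :
    Matrix ((L × P) × (L × P)) ((L × P) × (L × P)) ℂ :=
  ∑ z : Fin m → Z, prob M ρ z • (condLP M ρ z ⊗ₖ condBar M ρ z)

end

end AQEC

/-!
# Inner bounds on the channel fidelity from measured extensions

**Outer bound.** A pair of channels `E`, `D` corresponds to the pair of product states given by the
transposed Choi matrices (`objective_choi`, `choi_ofChoi`), and `ρ ⊗ σ^{⊗ n}` is feasible at level
`n` (`isFeasibleExt_kronecker_piTensor`). So every code fidelity is at most the optimal value of the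
level, and every point of `Σ_prod` has objective at most the channel fidelity, by convexity.

**Rounding.** Measuring `m` copies leaves `LP` and the first copy in a state whose average distance
from a product is controlled by the decrease of the conditional entropy of `LP` when the first copy
is measured as well. By permutation symmetry these decreases telescope
(`exists_sum_traceNorm_le`): their sum over `m < n` is at most the entropy of `LP`, hence at most
`ln d`, because conditioning is on classical data and the last entropy is nonnegative. Thus some `m`
has decrease at most `ln d / n`. The decrease is an average of relative entropies
(`exists_relEntropy`), Pinsker's inequality turns it into a trace distance of measured operators, and
the distortion `c` into a trace distance of operators on `LP L̄P̄`. The linear constraints of the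
hierarchy survive the measurement, so the rounded point lies in `Σ_prod` (`rounded_mem_SigmaProd`).

**Pinsker's inequality** (`pinsker`) is proved without monotonicity of the relative entropy: in
eigenbases of the two operators the relative entropy is the one of two classical distributions with
the weights `|⟨i|j⟩|²`, and the trace distance is bounded by the Cauchy-Schwarz inequality and
`x - y + 3 (x - y)² / (2 (x + 2 y)) ≤ x ln x - x ln y`.

**A measurement with distortion `2 d`** is given by the projectors onto `|x⟩ + Iᵗ|y⟩`, suitably
scaled, where `I` is the imaginary unit: by polarization (`single_eq_sum_polMeas`) they recover all
blocks of an operator.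
-/

set_option linter.unusedSectionVars false

namespace AQEC

open Matrix

/-! ### Spectral sums and the trace norm -/

/-- `X = Q diag(e) Qᴴ` with a unitary `Q` and real `e`. -/
structure IsDiagonalization {a : Type} [Fintype a] [DecidableEq a] (X Q : Matrix a a ℂ)
    (e : a → ℝ) : Prop where
  left : Qᴴ * Q = 1
  right : Q * Qᴴ = 1
  eq : X = Q * diagonal (fun i => (e i : ℂ)) * Qᴴ

section Spectral

variable {a : Type} [Fintype a] [DecidableEq a] {X Q : Matrix a a ℂ} {e : a → ℝ}

theorem isDiagonalization_eigenvalues (hX : X.IsHermitian) :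
    IsDiagonalization X (hX.eigenvectorUnitary : Matrix a a ℂ) hX.eigenvalues := by
  refine ⟨?_, ?_, ?_⟩
  · exact (Matrix.mem_unitaryGroup_iff').1 hX.eigenvectorUnitary.2
  · exact (Matrix.mem_unitaryGroup_iff).1 hX.eigenvectorUnitary.2
  · conv_lhs => rw [hX.spectral_theorem, Unitary.conjStarAlgAut_apply]
    rfl

theorem IsDiagonalization.isHermitian (h : IsDiagonalization X Q e) : X.IsHermitian := by
  rw [h.eq, IsHermitian]
  simp only [conjTranspose_mul, conjTranspose_conjTranspose, diagonal_conjTranspose,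
    Matrix.mul_assoc]
  congr 3
  ext i
  simp

theorem IsDiagonalization.charpoly (h : IsDiagonalization X Q e) :
    X.charpoly = ∏ i, (Polynomial.X - Polynomial.C (e i : ℂ)) := by
  rw [h.eq, charpoly_mul_comm, ← Matrix.mul_assoc, h.left, Matrix.one_mul, charpoly_diagonal]

theorem IsDiagonalization.sum_congr {Q' : Matrix a a ℂ} {e' : a → ℝ}
    (h : IsDiagonalization X Q e) (h' : IsDiagonalization X Q' e') (f : ℝ → ℝ) :
    ∑ i, f (e i) = ∑ i, f (e' i) := by
  have hr : ∀ {Q : Matrix a a ℂ} {e : a → ℝ}, IsDiagonalization X Q e →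
      X.charpoly.roots = Finset.univ.val.map (fun i => (e i : ℂ)) := by
    intro Q e h
    rw [h.charpoly, Polynomial.roots_prod]
    · simp
    · exact Finset.prod_ne_zero_iff.2 fun i _ => Polynomial.X_sub_C_ne_zero _
  have key := congrArg (fun s => (s.map (fun z : ℂ => f z.re)).sum) ((hr h).symm.trans (hr h'))
  simpa [Multiset.map_map] using key

open Classical in
/-- `∑ᵢ f(λᵢ)` over the eigenvalues of a Hermitian matrix, i.e. the trace of `f(X)`
(zero if `X` is not Hermitian). -/
noncomputable def spectralSum (f : ℝ → ℝ) (X : Matrix a a ℂ) : ℝ :=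
  if h : X.IsHermitian then ∑ i, f (h.eigenvalues i) else 0

theorem IsDiagonalization.spectralSum_eq (h : IsDiagonalization X Q e) (f : ℝ → ℝ) :
    spectralSum f X = ∑ i, f (e i) := by
  rw [spectralSum, dif_pos h.isHermitian]
  exact (isDiagonalization_eigenvalues h.isHermitian).sum_congr h f

theorem IsDiagonalization.conjTranspose_mul_self (h : IsDiagonalization X Q e) :
    IsDiagonalization (Xᴴ * X) Q (fun i => e i ^ 2) := by
  refine ⟨h.left, h.right, ?_⟩
  rw [h.isHermitian.eq]
  conv_lhs => rw [h.eq]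
  calc _ = Q * diagonal (fun i => (e i : ℂ)) * (Qᴴ * Q) * diagonal (fun i => (e i : ℂ)) * Qᴴ := by
        simp only [Matrix.mul_assoc]
    _ = _ := by
        rw [h.left, Matrix.mul_one, Matrix.mul_assoc Q, diagonal_mul_diagonal]
        simp [pow_two]

theorem IsDiagonalization.traceNorm_eq (h : IsDiagonalization X Q e) :
    traceNorm X = ∑ i, |e i| := by
  have h1 := (isDiagonalization_eigenvalues
    (isHermitian_conjTranspose_mul_self X)).sum_congr h.conjTranspose_mul_self Real.sqrt
  simpa [traceNorm, Real.sqrt_sq_eq_abs] using h1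

theorem traceNorm_nonneg (X : Matrix a a ℂ) : 0 ≤ traceNorm X :=
  Finset.sum_nonneg fun _ _ => Real.sqrt_nonneg _

theorem IsDiagonalization.trace_mul (h : IsDiagonalization X Q e) (C : Matrix a a ℂ) :
    (C * X).trace = ∑ i, (e i : ℂ) * (Qᴴ * C * Q) i i := by
  conv_lhs => rw [h.eq, ← Matrix.mul_assoc, trace_mul_comm, ← Matrix.mul_assoc, ← Matrix.mul_assoc]
  simp [Matrix.trace, mul_diagonal, mul_comm]

theorem IsDiagonalization.trace_eq (h : IsDiagonalization X Q e) :
    X.trace = ((∑ i, e i : ℝ) : ℂ) := by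
  have := h.trace_mul 1
  simpa [h.left] using this

theorem IsDiagonalization.nonneg (h : IsDiagonalization X Q e) (hX : X.PosSemidef) (i : a) :
    0 ≤ e i := by
  have h1 : Qᴴ * X * Q = diagonal (fun i => (e i : ℂ)) := by
    conv_lhs => rw [h.eq]
    calc _ = (Qᴴ * Q) * diagonal (fun i => (e i : ℂ)) * (Qᴴ * Q) := by
          simp only [Matrix.mul_assoc]
      _ = _ := by simp [h.left]
  have h2 := (hX.conjTranspose_mul_mul_same Q).diag_nonneg (i := i)
  rw [h1, diagonal_apply_eq] at h2
  exact_mod_cast h2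

/-! ### The operator norm -/

open scoped Matrix.Norms.L2Operator in
theorem opNorm_eq_norm (X : Matrix a a ℂ) : opNorm X = ‖X‖ := rfl

theorem opNorm_nonneg (X : Matrix a a ℂ) : 0 ≤ opNorm X := norm_nonneg _

open scoped Matrix.Norms.L2Operator in
theorem norm_apply_le_opNorm (X : Matrix a a ℂ) (i j : a) : ‖X i j‖ ≤ opNorm X := by
  have h := Matrix.l2_opNorm_mulVec X (EuclideanSpace.single j (1 : ℂ))
  have h2 := PiLp.norm_apply_le (WithLp.toLp 2 (X *ᵥ (EuclideanSpace.single j (1 : ℂ)).ofLp) :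
    EuclideanSpace ℂ a) i
  rw [opNorm_eq_norm]
  simpa using h2.trans h

theorem opNorm_mul_le (X Y : Matrix a a ℂ) : opNorm (X * Y) ≤ opNorm X * opNorm Y := by
  open scoped Matrix.Norms.L2Operator in
  simpa only [opNorm_eq_norm] using Matrix.l2_opNorm_mul X Y

theorem opNorm_one_le : opNorm (1 : Matrix a a ℂ) ≤ 1 := by
  rw [opNorm, map_one]
  exact ContinuousLinearMap.norm_id_le

theorem opNorm_conjTranspose (X : Matrix a a ℂ) : opNorm Xᴴ = opNorm X := by
  open scoped Matrix.Norms.L2Operator in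
  simpa only [opNorm_eq_norm] using Matrix.l2_opNorm_conjTranspose X

theorem opNorm_conjTranspose_mul_self (X : Matrix a a ℂ) :
    opNorm (Xᴴ * X) = opNorm X * opNorm X := by
  open scoped Matrix.Norms.L2Operator in
  simpa only [opNorm_eq_norm] using Matrix.l2_opNorm_conjTranspose_mul_self X

theorem opNorm_le_one_of_conjTranspose_mul_self {U : Matrix a a ℂ} (h : Uᴴ * U = 1) :
    opNorm U ≤ 1 := by
  have h1 := opNorm_conjTranspose_mul_self U
  rw [h] at h1
  nlinarith [opNorm_one_le (a := a), opNorm_nonneg U]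

/-- Hölder's inequality for the trace norm and the operator norm. -/
theorem norm_trace_mul_le (C : Matrix a a ℂ) (hX : X.IsHermitian) :
    ‖(C * X).trace‖ ≤ opNorm C * traceNorm X := by
  have h := isDiagonalization_eigenvalues hX
  rw [h.trace_mul C, h.traceNorm_eq, Finset.mul_sum]
  refine (norm_sum_le _ _).trans (Finset.sum_le_sum fun i _ => ?_)
  have hQ := opNorm_le_one_of_conjTranspose_mul_self h.left
  set Q : Matrix a a ℂ := (hX.eigenvectorUnitary : Matrix a a ℂ)
  have h1 : opNorm (Qᴴ * C * Q) ≤ opNorm C := by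
    calc opNorm (Qᴴ * C * Q) ≤ opNorm (Qᴴ * C) * opNorm Q := opNorm_mul_le _ _
      _ ≤ opNorm (Qᴴ * C) := mul_le_of_le_one_right (opNorm_nonneg _) hQ
      _ ≤ opNorm Qᴴ * opNorm C := opNorm_mul_le _ _
      _ ≤ opNorm C := mul_le_of_le_one_left (opNorm_nonneg _) (by rwa [opNorm_conjTranspose])
  rw [norm_mul, mul_comm, Complex.norm_real, Real.norm_eq_abs]
  exact mul_le_mul_of_nonneg_right ((norm_apply_le_opNorm _ i i).trans h1) (abs_nonneg _)

/-- The sign of a Hermitian matrix is a unitary which attains the trace norm. -/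
theorem exists_unitary_trace_mul_eq (hX : X.IsHermitian) :
    ∃ U : Matrix a a ℂ, Uᴴ * U = 1 ∧ U * Uᴴ = 1 ∧ (U * X).trace = (traceNorm X : ℂ) := by
  have h := isDiagonalization_eigenvalues hX
  set Q : Matrix a a ℂ := (hX.eigenvectorUnitary : Matrix a a ℂ)
  set e := hX.eigenvalues
  -- the sign of zero is one, which makes the sign unitary also on the kernel
  set s : a → ℂ := fun i => if 0 ≤ e i then 1 else -1 with hs
  have hss : ∀ i, s i * s i = 1 := fun i => by simp only [hs]; split_ifs <;> norm_num
  have hU : (Q * diagonal s * Qᴴ)ᴴ = Q * diagonal s * Qᴴ := by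
    simp only [conjTranspose_mul, conjTranspose_conjTranspose, diagonal_conjTranspose,
      Matrix.mul_assoc]
    congr 3
    ext i
    simp only [hs, Pi.star_apply]
    split_ifs <;> simp
  have hUU : (Q * diagonal s * Qᴴ) * (Q * diagonal s * Qᴴ) = 1 := by
    calc _ = Q * diagonal s * (Qᴴ * Q) * diagonal s * Qᴴ := by simp only [Matrix.mul_assoc]
      _ = 1 := by
        rw [h.left, Matrix.mul_one, Matrix.mul_assoc Q, diagonal_mul_diagonal]
        simp [hss, h.right]
  refine ⟨Q * diagonal s * Qᴴ, by rw [hU, hUU], by rw [hU, hUU], ?_⟩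
  have h1 : Qᴴ * (Q * diagonal s * Qᴴ) * Q = diagonal s := by
    calc _ = (Qᴴ * Q) * diagonal s * (Qᴴ * Q) := by simp only [Matrix.mul_assoc]
      _ = _ := by simp [h.left]
  rw [h.trace_mul, h1, h.traceNorm_eq]
  push_cast
  refine Finset.sum_congr rfl fun i _ => ?_
  simp only [diagonal_apply_eq, hs]
  split_ifs with h0
  · simp [abs_of_nonneg h0]
  · simp [abs_of_neg (not_le.1 h0)]

/-- The operator norm of a positive semidefinite matrix is at most its trace. -/
theorem opNorm_le_trace (hX : X.PosSemidef) : opNorm X ≤ X.trace.re := by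
  have h := isDiagonalization_eigenvalues hX.isHermitian
  have hQ := opNorm_le_one_of_conjTranspose_mul_self h.left
  have h0 := h.nonneg hX
  rw [h.trace_eq, Complex.ofReal_re]
  set Q : Matrix a a ℂ := (hX.isHermitian.eigenvectorUnitary : Matrix a a ℂ)
  set e := hX.isHermitian.eigenvalues
  have h1 : opNorm X ≤ opNorm (diagonal (fun i => (e i : ℂ))) := by
    calc opNorm X = opNorm (Q * diagonal (fun i => (e i : ℂ)) * Qᴴ) := by rw [← h.eq]
      _ ≤ opNorm (Q * diagonal (fun i => (e i : ℂ))) * opNorm Qᴴ := opNorm_mul_le _ _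
      _ ≤ opNorm (Q * diagonal (fun i => (e i : ℂ))) :=
        mul_le_of_le_one_right (opNorm_nonneg _) (by rwa [opNorm_conjTranspose])
      _ ≤ opNorm Q * opNorm (diagonal (fun i => (e i : ℂ))) := opNorm_mul_le _ _
      _ ≤ _ := mul_le_of_le_one_left (opNorm_nonneg _) hQ
  refine h1.trans ?_
  open scoped Matrix.Norms.L2Operator in
  rw [opNorm_eq_norm, Matrix.l2_opNorm_diagonal]
  refine (pi_norm_le_iff_of_nonneg (Finset.sum_nonneg fun i _ => h0 i)).2 fun i => ?_
  rw [Complex.norm_real, Real.norm_of_nonneg (h0 i)]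
  exact Finset.single_le_sum (fun j _ => h0 j) (Finset.mem_univ i)

end Spectral

/-! ### Pinsker's inequality and the Holevo information of an ensemble -/

/-- The difference of the two sides has derivative `(t - 1)³ / (t² (t + 2)²)` and vanishes at
`t = 1`. -/
theorem rational_le_log {t : ℝ} (ht : 0 < t) :
    (t - 1) * (5 * t + 1) / (2 * t * (t + 2)) ≤ Real.log t := by
  set g : ℝ → ℝ := fun t => Real.log t - (t - 1) * (5 * t + 1) / (2 * t * (t + 2)) with hg
  have hd : ∀ x : ℝ, 0 < x → HasDerivAt g ((x - 1) ^ 3 / (x ^ 2 * (x + 2) ^ 2)) x := by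
    intro x hx
    have h2 : HasDerivAt (fun t : ℝ => (t - 1) * (5 * t + 1)) (1 * (5 * x + 1) + (x - 1) * (5 * 1))
        x :=
      ((hasDerivAt_id x).sub_const 1).mul (((hasDerivAt_id x).const_mul 5).add_const 1)
    have h3 : HasDerivAt (fun t : ℝ => 2 * t * (t + 2)) (2 * 1 * (x + 2) + 2 * x * 1) x :=
      ((hasDerivAt_id x).const_mul 2).mul ((hasDerivAt_id x).add_const 2)
    have h := (Real.hasDerivAt_log hx.ne').sub (h2.div h3 (by positivity))
    refine HasDerivAt.congr_deriv (f := g) h ?_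
    field_simp
    ring
  have h1 : g 1 = 0 := by simp [hg]
  suffices 0 ≤ g t by simpa [hg] using this
  rcases le_total 1 t with h | h
  · have hm : MonotoneOn g (Set.Icc 1 t) := by
      refine monotoneOn_of_hasDerivWithinAt_nonneg
        (f' := fun x => (x - 1) ^ 3 / (x ^ 2 * (x + 2) ^ 2)) (convex_Icc 1 t)
        (fun x hx => (hd x (by linarith [hx.1])).continuousAt.continuousWithinAt) ?_ ?_
      · intro x hx
        rw [interior_Icc] at hx
        exact (hd x (by linarith [hx.1])).hasDerivWithinAt
      · intro x hx
        rw [interior_Icc] at hx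
        have : 0 ≤ x - 1 := by linarith [hx.1]
        positivity
    rw [← h1]
    exact hm ⟨le_rfl, h⟩ ⟨h, le_rfl⟩ h
  · have hm : AntitoneOn g (Set.Icc t 1) := by
      refine antitoneOn_of_hasDerivWithinAt_nonpos
        (f' := fun x => (x - 1) ^ 3 / (x ^ 2 * (x + 2) ^ 2)) (convex_Icc t 1)
        (fun x hx => (hd x (by linarith [hx.1])).continuousAt.continuousWithinAt) ?_ ?_
      · intro x hx
        rw [interior_Icc] at hx
        exact (hd x (by linarith [hx.1])).hasDerivWithinAt
      · intro x hx
        rw [interior_Icc] at hx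
        have h3 : (x - 1) ^ 3 ≤ 0 := by
          have : x - 1 ≤ 0 := by linarith [hx.2]
          exact Odd.pow_nonpos (by decide) this
        exact div_nonpos_of_nonpos_of_nonneg h3 (by positivity)
    rw [← h1]
    exact hm ⟨le_rfl, h⟩ ⟨h, le_rfl⟩ h

/-- The scalar inequality behind Pinsker's inequality with the optimal constant. -/
theorem mul_log_sub_ge {x y : ℝ} (hx : 0 ≤ x) (hy : 0 < y) :
    x - y + 3 * (x - y) ^ 2 / (2 * (x + 2 * y)) ≤ x * Real.log x - x * Real.log y := by
  rcases hx.eq_or_lt with rfl | hx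
  · have : 0 - y + 3 * (0 - y) ^ 2 / (2 * (0 + 2 * y)) = - y / 4 := by field_simp; ring
    rw [this]
    simp only [zero_mul, sub_zero]
    linarith
  · have h := rational_le_log (t := x / y) (by positivity)
    rw [Real.log_div hx.ne' hy.ne'] at h
    have h2 := mul_le_mul_of_nonneg_left h hx.le
    rw [mul_sub] at h2
    refine le_trans (le_of_eq ?_) h2
    field_simp
    ring

section Pinsker

variable {a : Type} [Fintype a] [DecidableEq a]

theorem sum_normSq_row {U : Matrix a a ℂ} (h : U * Uᴴ = 1) (i : a) :
    ∑ j, ‖U i j‖ ^ 2 = 1 := by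
  have h1 := congrFun (congrFun h i) i
  rw [mul_apply, one_apply_eq] at h1
  have h2 : ∀ j, U i j * Uᴴ j i = ((‖U i j‖ ^ 2 : ℝ) : ℂ) := fun j => by
    rw [conjTranspose_apply, ← starRingEnd_apply, Complex.mul_conj, Complex.normSq_eq_norm_sq]
  simp only [h2] at h1
  exact_mod_cast h1

theorem sum_normSq_col {U : Matrix a a ℂ} (h : Uᴴ * U = 1) (j : a) :
    ∑ i, ‖U i j‖ ^ 2 = 1 := by
  have := sum_normSq_row (U := Uᴴ) (by simpa using h) j
  simpa [conjTranspose_apply] using this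

theorem IsDiagonalization.conj_apply {A Q : Matrix a a ℂ} {α : a → ℝ}
    (hA : IsDiagonalization A Q α) (R : Matrix a a ℂ) (j : a) :
    (Rᴴ * A * R) j j = ((∑ i, α i * ‖(Qᴴ * R) i j‖ ^ 2 : ℝ) : ℂ) := by
  have h1 : Rᴴ * A * R = (Qᴴ * R)ᴴ * diagonal (fun i => (α i : ℂ)) * (Qᴴ * R) := by
    conv_lhs => rw [hA.eq]
    simp only [conjTranspose_mul, conjTranspose_conjTranspose, Matrix.mul_assoc]
  rw [h1, mul_apply]
  push_cast
  refine Finset.sum_congr rfl fun i _ => ?_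
  rw [mul_diagonal, conjTranspose_apply, ← starRingEnd_apply, mul_right_comm, mul_comm _ (α i : ℂ),
    Complex.conj_mul']

/-- Pinsker's inequality for positive semidefinite `A` and `s B` of equal trace, where `A ≤ B`. The
relative entropy `tr A (log A - log (s B))` is expanded in an eigenbasis `Q` of `A` and an
eigenbasis `R` of `B`; with the transition probabilities `|(Qᴴ R)ᵢⱼ|²` it becomes a classical one,
and the Cauchy-Schwarz inequality reduces the bound to `mul_log_sub_ge`. -/
theorem pinsker {A B Q R : Matrix a a ℂ} {α β : a → ℝ} (hA : IsDiagonalization A Q α)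
    (hB : IsDiagonalization B R β) (hA0 : A.PosSemidef) (hB0 : B.PosSemidef)
    (hAB : (B - A).PosSemidef) {s : ℝ} (hs : 0 < s) (hsum : ∑ i, α i = s * ∑ j, β j) :
    traceNorm (A - s • B) ^ 2 ≤ 2 * (∑ i, α i) * (∑ i, α i * Real.log (α i) -
      ∑ j, Real.log (β j) * ((Rᴴ * A * R) j j).re - (∑ i, α i) * Real.log s) := by
  have hα := hA.nonneg hA0
  have hβ := hB.nonneg hB0
  have hherm : (A - s • B).IsHermitian := by
    refine hA.isHermitian.sub ?_
    rw [IsHermitian, conjTranspose_smul, hB.isHermitian.eq]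
    simp
  obtain ⟨U, hU1, hU2, hU⟩ := exists_unitary_trace_mul_eq hherm
  set W := Qᴴ * R with hW
  set K := Rᴴ * U * Q with hK
  have hWr : W * Wᴴ = 1 := by
    rw [hW, conjTranspose_mul, conjTranspose_conjTranspose]
    calc _ = Qᴴ * (R * Rᴴ) * Q := by simp only [Matrix.mul_assoc]
      _ = 1 := by rw [hB.right, Matrix.mul_one, hA.left]
  have hWc : Wᴴ * W = 1 := by
    rw [hW, conjTranspose_mul, conjTranspose_conjTranspose]
    calc _ = Rᴴ * (Q * Qᴴ) * R := by simp only [Matrix.mul_assoc]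
      _ = 1 := by rw [hA.right, Matrix.mul_one, hB.left]
  have hKr : K * Kᴴ = 1 := by
    rw [hK, conjTranspose_mul, conjTranspose_mul, conjTranspose_conjTranspose]
    calc _ = Rᴴ * (U * (Q * Qᴴ) * Uᴴ) * R := by simp only [Matrix.mul_assoc]
      _ = 1 := by rw [hA.right, Matrix.mul_one, hU2, Matrix.mul_one, hB.left]
  have hKc : Kᴴ * K = 1 := by
    rw [hK, conjTranspose_mul, conjTranspose_mul, conjTranspose_conjTranspose]
    calc _ = Qᴴ * (Uᴴ * (R * Rᴴ) * U) * Q := by simp only [Matrix.mul_assoc]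
      _ = 1 := by rw [hB.right, Matrix.mul_one, hU1, Matrix.mul_one, hA.left]
  -- the trace in the two eigenbases
  have htr : (traceNorm (A - s • B) : ℂ) = ∑ p : a × a, K p.2 p.1 * W p.1 p.2 *
      ((α p.1 - s * β p.2 : ℝ) : ℂ) := by
    have e1 : (U * A).trace = ∑ p : a × a, K p.2 p.1 * W p.1 p.2 * (α p.1 : ℂ) := by
      have : (U * A).trace = (K * diagonal (fun i => (α i : ℂ)) * W).trace := by
        conv_lhs => rw [hA.eq]
        rw [hK, hW]
        calc _ = ((R * Rᴴ) * (U * (Q * diagonal (fun i => (α i : ℂ)) * Qᴴ))).trace := by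
              rw [hB.right, Matrix.one_mul]
          _ = (R * (Rᴴ * U * Q * diagonal (fun i => (α i : ℂ)) * Qᴴ)).trace := by
              simp only [Matrix.mul_assoc]
          _ = _ := by rw [trace_mul_comm]; simp only [Matrix.mul_assoc]
      rw [this, Fintype.sum_prod_type_right]
      simp only [Matrix.trace, diag_apply, mul_apply (M := K * _), mul_diagonal]
      exact Finset.sum_congr rfl fun j _ => Finset.sum_congr rfl fun i _ => by ring
    have e2 : (U * B).trace = ∑ p : a × a, K p.2 p.1 * W p.1 p.2 * (β p.2 : ℂ) := by
      have : (U * B).trace = (W * diagonal (fun i => (β i : ℂ)) * K).trace := by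
        conv_lhs => rw [hB.eq]
        rw [hK, hW, trace_mul_comm U]
        calc _ = ((R * diagonal (fun i => (β i : ℂ)) * Rᴴ * U) * (Q * Qᴴ)).trace := by
              rw [hA.right, Matrix.mul_one]
          _ = ((R * diagonal (fun i => (β i : ℂ)) * Rᴴ * U * Q) * Qᴴ).trace := by
              simp only [Matrix.mul_assoc]
          _ = _ := by rw [trace_mul_comm]; simp only [Matrix.mul_assoc]
      rw [this, Fintype.sum_prod_type]
      simp only [Matrix.trace, diag_apply, mul_apply (M := W * _), mul_diagonal]
      exact Finset.sum_congr rfl fun j _ => Finset.sum_congr rfl fun i _ => by ring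
    rw [← hU, Matrix.mul_sub, trace_sub, Matrix.mul_smul, trace_smul, e1, e2, Complex.real_smul,
      Finset.mul_sum, ← Finset.sum_sub_distrib]
    refine Finset.sum_congr rfl fun p _ => ?_
    push_cast
    ring
  have hle : traceNorm (A - s • B) ≤ ∑ p : a × a, ‖K p.2 p.1‖ * ‖W p.1 p.2‖ *
      |α p.1 - s * β p.2| := by
    have h1 := congrArg norm htr
    rw [Complex.norm_real, Real.norm_of_nonneg (traceNorm_nonneg _)] at h1
    rw [h1]
    refine (norm_sum_le _ _).trans (le_of_eq (Finset.sum_congr rfl fun p _ => ?_))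
    rw [norm_mul, norm_mul, Complex.norm_real, Real.norm_eq_abs]
  -- the support of `A` lies in the one of `B`
  have hsupp : ∀ i j, β j = 0 → α i * ‖W i j‖ ^ 2 = 0 := by
    intro i j hj
    have h1 := (hAB.conjTranspose_mul_mul_same R).diag_nonneg (i := j)
    have h2 : Rᴴ * B * R = diagonal (fun i => (β i : ℂ)) := by
      conv_lhs => rw [hB.eq]
      calc _ = (Rᴴ * R) * diagonal (fun i => (β i : ℂ)) * (Rᴴ * R) := by
            simp only [Matrix.mul_assoc]
        _ = _ := by simp [hB.left]
    rw [Matrix.mul_sub, Matrix.sub_mul, Matrix.sub_apply, h2, diagonal_apply_eq, hj,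
      hA.conj_apply] at h1
    have h3 : ∑ i, α i * ‖W i j‖ ^ 2 ≤ 0 := by
      have : (0 : ℂ) ≤ ((-(∑ i, α i * ‖W i j‖ ^ 2) : ℝ) : ℂ) := by simpa using h1
      have := Complex.zero_le_real.1 this
      linarith
    have h4 : ∀ i ∈ Finset.univ, 0 ≤ α i * ‖W i j‖ ^ 2 := fun i _ =>
      mul_nonneg (hα i) (sq_nonneg _)
    exact (Finset.sum_eq_zero_iff_of_nonneg h4).1 (le_antisymm h3 (Finset.sum_nonneg h4)) i
      (Finset.mem_univ i)
  set D : a × a → ℝ := fun p => ‖W p.1 p.2‖ ^ 2 *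
    (3 * (α p.1 - s * β p.2) ^ 2 / (2 * (α p.1 + 2 * (s * β p.2)))) with hD
  set E : a × a → ℝ := fun p => ‖K p.2 p.1‖ ^ 2 * (2 / 3 * (α p.1 + 2 * (s * β p.2))) with hE
  have hden : ∀ p : a × a, 0 ≤ α p.1 + 2 * (s * β p.2) := fun p => by
    have := hα p.1
    have := hβ p.2
    positivity
  have hCS : traceNorm (A - s • B) ^ 2 ≤ (∑ p, E p) * ∑ p, D p := by
    refine (pow_le_pow_left₀ (traceNorm_nonneg _) hle 2).trans ?_
    refine Finset.sum_sq_le_sum_mul_sum_of_sq_le_mul _ (fun p _ => ?_) (fun p _ => ?_)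
      (fun p _ => ?_)
    · exact mul_nonneg (sq_nonneg _) (mul_nonneg (by norm_num) (hden p))
    · exact mul_nonneg (sq_nonneg _) (div_nonneg (by positivity)
        (mul_nonneg (by norm_num) (hden p)))
    · rw [mul_pow, mul_pow, sq_abs]
      rcases (hden p).eq_or_lt with h0 | h0
      · have h1 : α p.1 = 0 := by nlinarith [hα p.1, mul_nonneg hs.le (hβ p.2)]
        have h2 : s * β p.2 = 0 := by nlinarith [hα p.1, mul_nonneg hs.le (hβ p.2)]
        simp [hD, hE, h1, h2]
      · refine le_of_eq ?_
        simp only [hD, hE]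
        have h1 := h0.ne'
        generalize α p.1 + 2 * (s * β p.2) = y at h1
        field_simp
  have hEsum : ∑ p, E p = 2 * ∑ i, α i := by
    have h1 : ∑ p, E p = 2 / 3 * ∑ p : a × a, ‖K p.2 p.1‖ ^ 2 * α p.1 +
        4 / 3 * s * ∑ p : a × a, ‖K p.2 p.1‖ ^ 2 * β p.2 := by
      rw [Finset.mul_sum, Finset.mul_sum, ← Finset.sum_add_distrib]
      exact Finset.sum_congr rfl fun p _ => by simp only [hE]; ring
    rw [h1, Fintype.sum_prod_type, Fintype.sum_prod_type_right]
    simp only [← Finset.sum_mul, sum_normSq_col hKc, sum_normSq_row hKr, one_mul]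
    linarith
  have hDsum : ∑ p, D p ≤ ∑ i, α i * Real.log (α i) -
      ∑ j, Real.log (β j) * ((Rᴴ * A * R) j j).re - (∑ i, α i) * Real.log s := by
    have hterm : ∀ p : a × a, D p ≤ ‖W p.1 p.2‖ ^ 2 * (α p.1 * Real.log (α p.1)) -
        Real.log (β p.2) * (α p.1 * ‖W p.1 p.2‖ ^ 2) - ‖W p.1 p.2‖ ^ 2 * α p.1 * Real.log s -
        ‖W p.1 p.2‖ ^ 2 * α p.1 + s * (‖W p.1 p.2‖ ^ 2 * β p.2) := by
      intro p
      rcases (hβ p.2).eq_or_lt with h0 | h0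
      · have h1 := hsupp p.1 p.2 h0.symm
        rcases mul_eq_zero.1 h1 with h2 | h2
        · simp [hD, h2, ← h0]
        · simp [hD, h2]
      · have h1 := mul_log_sub_ge (hα p.1) (mul_pos hs h0)
        rw [Real.log_mul hs.ne' h0.ne'] at h1
        have h2 := mul_le_mul_of_nonneg_left h1 (sq_nonneg ‖W p.1 p.2‖)
        simp only [hD]
        linarith
    refine (Finset.sum_le_sum fun p _ => hterm p).trans (le_of_eq ?_)
    simp only [Finset.sum_add_distrib, Finset.sum_sub_distrib]
    have e1 : ∑ p : a × a, ‖W p.1 p.2‖ ^ 2 * (α p.1 * Real.log (α p.1)) =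
        ∑ i, α i * Real.log (α i) := by
      rw [Fintype.sum_prod_type]
      simp only [← Finset.sum_mul, sum_normSq_row hWr, one_mul]
    have e2 : ∑ p : a × a, ‖W p.1 p.2‖ ^ 2 * α p.1 = ∑ i, α i := by
      rw [Fintype.sum_prod_type]
      simp only [← Finset.sum_mul, sum_normSq_row hWr, one_mul]
    have e3 : ∑ p : a × a, ‖W p.1 p.2‖ ^ 2 * β p.2 = ∑ j, β j := by
      rw [Fintype.sum_prod_type_right]
      simp only [← Finset.sum_mul, sum_normSq_col hWc, one_mul]
    have e4 : ∑ p : a × a, Real.log (β p.2) * (α p.1 * ‖W p.1 p.2‖ ^ 2) =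
        ∑ j, Real.log (β j) * ((Rᴴ * A * R) j j).re := by
      rw [Fintype.sum_prod_type_right]
      simp only [hA.conj_apply, Complex.ofReal_re, ← hW, Finset.mul_sum]
    rw [e1, e4, ← Finset.sum_mul, ← Finset.mul_sum, e2, e3, hsum]
    ring
  rw [hEsum] at hCS
  refine hCS.trans (mul_le_mul_of_nonneg_left hDsum ?_)
  have := Finset.sum_nonneg fun i (_ : i ∈ Finset.univ) => hα i
  positivity

/-- `p S(X / p)` for a positive semidefinite matrix `X` of trace `p`, with the von Neumann
entropy `S`. -/
noncomputable def condEntropy (X : Matrix a a ℂ) : ℝ :=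
  spectralSum Real.negMulLog X - Real.negMulLog X.trace.re

theorem condEntropy_nonneg {X : Matrix a a ℂ} (hX : X.PosSemidef) : 0 ≤ condEntropy X := by
  have h := isDiagonalization_eigenvalues hX.isHermitian
  have h0 := h.nonneg hX
  rw [condEntropy, h.spectralSum_eq, h.trace_eq, Complex.ofReal_re, sub_nonneg, Real.negMulLog,
    neg_mul, Finset.sum_mul, ← Finset.sum_neg_distrib]
  refine Finset.sum_le_sum fun i _ => ?_
  rw [Real.negMulLog, neg_mul, neg_le_neg_iff]
  rcases (h0 i).eq_or_lt with h1 | h1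
  · simp [← h1]
  · exact mul_le_mul_of_nonneg_left (Real.log_le_log h1
      (Finset.single_le_sum (fun j _ => h0 j) (Finset.mem_univ i))) h1.le

theorem condEntropy_le_log_card {X : Matrix a a ℂ} (hX : X.PosSemidef) (htr : X.trace = 1) :
    condEntropy X ≤ Real.log (Fintype.card a) := by
  have h := isDiagonalization_eigenvalues hX.isHermitian
  have h0 := h.nonneg hX
  have h1 : ∑ i, hX.isHermitian.eigenvalues i = 1 := by
    have := h.trace_eq
    rw [htr] at this
    exact_mod_cast this.symm
  have hne : Nonempty a := by
    by_contra hemp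
    rw [not_nonempty_iff] at hemp
    simp at h1
  have hd : (0 : ℝ) < Fintype.card a := by exact_mod_cast Fintype.card_pos
  rw [condEntropy, h.spectralSum_eq, htr]
  set e := hX.isHermitian.eigenvalues
  have hterm : ∀ i, Real.negMulLog (e i) ≤ e i * Real.log (Fintype.card a) +
      ((Fintype.card a : ℝ)⁻¹ - e i) := by
    intro i
    rcases (h0 i).eq_or_lt with h2 | h2
    · simp [← h2]
    · have h3 := Real.log_le_sub_one_of_pos (x := (Fintype.card a * e i)⁻¹) (by positivity)
      rw [Real.log_inv, Real.log_mul hd.ne' h2.ne'] at h3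
      have h4 := mul_le_mul_of_nonneg_left h3 h2.le
      have h5 : e i * ((Fintype.card a * e i)⁻¹ - 1) = (Fintype.card a : ℝ)⁻¹ - e i := by
        field_simp
      rw [Real.negMulLog]
      linarith
  have h2 := Finset.sum_le_sum fun i (_ : i ∈ Finset.univ) => hterm i
  rw [Finset.sum_add_distrib, Finset.sum_sub_distrib, ← Finset.sum_mul, h1] at h2
  simp only [Finset.sum_const, Finset.card_univ, nsmul_eq_mul] at h2
  rw [mul_inv_cancel₀ hd.ne'] at h2
  simpa using h2

theorem eq_zero_of_trace_re_eq_zero {X : Matrix a a ℂ} (hX : X.PosSemidef)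
    (h : X.trace.re = 0) : X = 0 := by
  have hd := isDiagonalization_eigenvalues hX.isHermitian
  rw [hd.trace_eq, Complex.ofReal_re] at h
  have h1 := (Finset.sum_eq_zero_iff_of_nonneg fun i _ => hd.nonneg hX i).1 h
  rw [hd.eq]
  have : (fun i => (hX.isHermitian.eigenvalues i : ℂ)) = 0 := by
    ext i
    simp [h1 i (Finset.mem_univ i)]
  rw [this]
  simp

theorem traceNorm_zero : traceNorm (0 : Matrix a a ℂ) = 0 := by
  have h : IsDiagonalization (0 : Matrix a a ℂ) 1 (fun _ => 0) :=
    ⟨by simp, by simp, by simp⟩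
  rw [h.traceNorm_eq]
  simp

/-- The ensemble with unnormalized members `A x` and average `∑ x, A x`: its Holevo information
`condEntropy (∑ x, A x) - ∑ x, condEntropy (A x)` is a sum of relative entropies `D x`, and Pinsker's
inequality applies to each of them. -/
theorem exists_relEntropy {ι : Type} [Fintype ι] (A : ι → Matrix a a ℂ)
    (hA : ∀ x, (A x).PosSemidef) :
    ∃ D : ι → ℝ, (∀ x, 0 ≤ D x) ∧
      (∀ x, traceNorm (A x - ((A x).trace.re / (∑ y, A y).trace.re) • ∑ y, A y) ^ 2 ≤
        2 * (A x).trace.re * D x) ∧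
      ∑ x, D x = condEntropy (∑ y, A y) - ∑ x, condEntropy (A x) := by
  classical
  set B := ∑ y, A y with hBdef
  have hB : B.PosSemidef := posSemidef_sum _ fun x _ => hA x
  have hdB := isDiagonalization_eigenvalues hB.isHermitian
  set R : Matrix a a ℂ := (hB.isHermitian.eigenvectorUnitary : Matrix a a ℂ)
  set β := hB.isHermitian.eigenvalues
  have hdA := fun x => isDiagonalization_eigenvalues (hA x).isHermitian
  have ht : ∀ x, (A x).trace.re = ∑ i, (hA x).isHermitian.eigenvalues i := fun x => by
    rw [(hdA x).trace_eq, Complex.ofReal_re]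
  have htB : B.trace.re = ∑ i, β i := by rw [hdB.trace_eq, Complex.ofReal_re]
  have ht0 : ∀ x, 0 ≤ (A x).trace.re := fun x => (Complex.nonneg_iff.1 (hA x).trace_nonneg).1
  have htsum : B.trace.re = ∑ x, (A x).trace.re := by
    rw [hBdef, trace_sum, Complex.re_sum]
  have htle : ∀ x, (A x).trace.re ≤ B.trace.re := fun x => by
    rw [htsum]
    exact Finset.single_le_sum (f := fun x => (A x).trace.re) (fun y _ => ht0 y)
      (Finset.mem_univ x)
  have hBA : ∀ x, (B - A x).PosSemidef := fun x => by
    have : B - A x = ∑ y ∈ Finset.univ.erase x, A y := by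
      rw [hBdef, ← Finset.add_sum_erase _ _ (Finset.mem_univ x), add_sub_cancel_left]
    rw [this]
    exact posSemidef_sum _ fun y _ => hA y
  set D : ι → ℝ := fun x => - spectralSum Real.negMulLog (A x) -
    ∑ j, Real.log (β j) * ((Rᴴ * A x * R) j j).re -
    (A x).trace.re * Real.log ((A x).trace.re / B.trace.re) with hD
  have hzero : ∀ x, (A x).trace.re = 0 → A x = 0 := fun x h =>
    eq_zero_of_trace_re_eq_zero (hA x) h
  have hspec0 : spectralSum Real.negMulLog (0 : Matrix a a ℂ) = 0 := by
    have h : IsDiagonalization (0 : Matrix a a ℂ) 1 (fun _ => 0) :=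
      ⟨by simp, by simp, by simp⟩
    rw [h.spectralSum_eq]
    simp
  have hpin : ∀ x, traceNorm (A x - ((A x).trace.re / B.trace.re) • B) ^ 2 ≤
      2 * (A x).trace.re * D x := by
    intro x
    rcases (ht0 x).eq_or_lt with h0 | h0
    · simp [hzero x h0.symm, traceNorm_zero]
    · have hBpos : 0 < B.trace.re := h0.trans_le (htle x)
      have h1 := pinsker (hdA x) hdB (hA x) hB (hBA x)
        (s := (A x).trace.re / B.trace.re) (by positivity)
        (by rw [← ht x, ← htB]; field_simp)
      rw [← ht x] at h1
      refine h1.trans (le_of_eq ?_)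
      simp only [hD]
      rw [(hdA x).spectralSum_eq, ← Finset.sum_neg_distrib]
      simp [Real.negMulLog]
  refine ⟨D, fun x => ?_, hpin, ?_⟩
  · rcases (ht0 x).eq_or_lt with h0 | h0
    · simp [hD, hzero x h0.symm, hspec0]
    · have h1 := (sq_nonneg _).trans (hpin x)
      exact nonneg_of_mul_nonneg_right h1 (by positivity)
  · have hlog : ∀ x, (A x).trace.re * Real.log ((A x).trace.re / B.trace.re) =
        - Real.negMulLog (A x).trace.re - (A x).trace.re * Real.log B.trace.re := by
      intro x
      rcases (ht0 x).eq_or_lt with h0 | h0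
      · simp [← h0]
      · rw [Real.log_div h0.ne' (h0.trans_le (htle x)).ne', Real.negMulLog]
        ring
    have hcross : ∑ x, ∑ j, Real.log (β j) * ((Rᴴ * A x * R) j j).re =
        - spectralSum Real.negMulLog B := by
      rw [Finset.sum_comm, hdB.spectralSum_eq, ← Finset.sum_neg_distrib]
      refine Finset.sum_congr rfl fun j _ => ?_
      have h2 : Rᴴ * B * R = diagonal (fun i => (β i : ℂ)) := by
        conv_lhs => rw [hdB.eq]
        calc _ = (Rᴴ * R) * diagonal (fun i => (β i : ℂ)) * (Rᴴ * R) := by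
              simp only [Matrix.mul_assoc]
          _ = _ := by simp [hdB.left]
      have h3 : ∑ x, ((Rᴴ * A x * R) j j).re = β j := by
        rw [← Complex.re_sum, ← Matrix.sum_apply, ← Finset.sum_mul, ← Finset.mul_sum, ← hBdef, h2,
          diagonal_apply_eq, Complex.ofReal_re]
      rw [← Finset.mul_sum, h3, Real.negMulLog]
      ring
    simp only [hD, hlog, condEntropy, Finset.sum_sub_distrib, Finset.sum_neg_distrib, hcross]
    rw [← Finset.sum_mul, ← htsum, Real.negMulLog]
    ring

end Pinsker

/-! ### Contractions of multipartite operators with effects -/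

section Contraction

variable {a b : Type} [Fintype a] [Fintype b]

/-- The partial contraction `tr_b[(𝟙 ⊗ W) X]`. -/
def partialContract (W : Matrix b b ℂ) (X : Matrix (a × b) (a × b) ℂ) : Matrix a a ℂ :=
  of fun i j => ∑ r, ∑ s, W r s * X (i, s) (j, r)

/-- The tensor product `⨂ₜ w t`. -/
def piTensor {ι : Type} [Fintype ι] (w : ι → Matrix b b ℂ) : Matrix (ι → b) (ι → b) ℂ :=
  of fun r s => ∏ t, w t (r t) (s t)

theorem exists_eq_conjTranspose_mul_self {X : Matrix b b ℂ} (hX : X.PosSemidef) :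
    ∃ B : Matrix b b ℂ, X = Bᴴ * B := by
  classical
  have h := isDiagonalization_eigenvalues hX.isHermitian
  have h0 := h.nonneg hX
  set Q : Matrix b b ℂ := (hX.isHermitian.eigenvectorUnitary : Matrix b b ℂ)
  set e := hX.isHermitian.eigenvalues
  refine ⟨diagonal (fun i => ((Real.sqrt (e i) : ℝ) : ℂ)) * Qᴴ, ?_⟩
  conv_lhs => rw [h.eq]
  rw [conjTranspose_mul, conjTranspose_conjTranspose, diagonal_conjTranspose, Matrix.mul_assoc,
    Matrix.mul_assoc, ← Matrix.mul_assoc (diagonal _), diagonal_mul_diagonal]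
  congr 3
  ext i
  simp only [Pi.star_apply, RCLike.star_def, Complex.conj_ofReal, ← Complex.ofReal_mul,
    Real.mul_self_sqrt (h0 i)]

theorem posSemidef_partialContract {W : Matrix b b ℂ} (hW : W.PosSemidef)
    {X : Matrix (a × b) (a × b) ℂ} (hX : X.PosSemidef) :
    (partialContract W X).PosSemidef := by
  classical
  obtain ⟨B, rfl⟩ := exists_eq_conjTranspose_mul_self hW
  have h : partialContract (Bᴴ * B) X = ∑ u, (of fun (i : a) (q : a × b) =>
      if i = q.1 then B u q.2 else 0) * X * (of fun (i : a) (q : a × b) =>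
      if i = q.1 then B u q.2 else 0)ᴴ := by
    ext i j
    simp only [partialContract, of_apply, mul_apply, conjTranspose_apply, Matrix.sum_apply,
      Fintype.sum_prod_type, Finset.sum_mul, apply_ite star, star_zero, mul_ite, ite_mul, zero_mul,
      mul_zero]
    simp only [Finset.sum_ite_irrel, Finset.sum_const_zero, Finset.sum_ite_eq, Finset.mem_univ,
      if_true]
    rw [Finset.sum_comm' (t' := Finset.univ) (s' := fun _ => Finset.univ) (by simp)]
    rw [Finset.sum_comm]
    conv_rhs => rw [Finset.sum_comm]
    refine Finset.sum_congr rfl fun r _ => ?_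
    rw [Finset.sum_comm]
    refine Finset.sum_congr rfl fun u _ => Finset.sum_congr rfl fun s _ => ?_
    ring
  rw [h]
  exact posSemidef_sum _ fun u _ => hX.mul_mul_conjTranspose_same _

theorem posSemidef_piTensor {ι : Type} [Fintype ι] {w : ι → Matrix b b ℂ}
    (hw : ∀ t, (w t).PosSemidef) : (piTensor w).PosSemidef := by
  classical
  choose B hB using fun t => exists_eq_conjTranspose_mul_self (hw t)
  have h : piTensor w = (piTensor B)ᴴ * piTensor B := by
    ext r s
    simp only [piTensor, of_apply, mul_apply, conjTranspose_apply, star_prod,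
      ← Finset.prod_mul_distrib]
    simp only [hB, mul_apply, conjTranspose_apply]
    rw [Finset.prod_univ_sum, Fintype.piFinset_univ]
  rw [h]
  exact posSemidef_conjTranspose_mul_self _

theorem piTensor_one {ι : Type} [Fintype ι] [DecidableEq ι] [DecidableEq b] :
    piTensor (fun _ : ι => (1 : Matrix b b ℂ)) = 1 := by
  ext r s
  simp only [piTensor, of_apply, one_apply, Finset.prod_ite_zero, Finset.prod_const_one,
    Finset.mem_univ, true_imp_iff, funext_iff]

theorem partialContract_one [DecidableEq b] (X : Matrix (a × b) (a × b) ℂ) :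
    partialContract 1 X = trSnd X := by
  ext i j
  simp [partialContract, trSnd, one_apply]

theorem partialContract_sum {ι : Type} (s : Finset ι) (W : ι → Matrix b b ℂ)
    (X : Matrix (a × b) (a × b) ℂ) :
    partialContract (∑ x ∈ s, W x) X = ∑ x ∈ s, partialContract (W x) X := by
  ext i j
  simp only [partialContract, of_apply, Matrix.sum_apply, Finset.sum_mul]
  rw [Finset.sum_comm (s := s)]
  exact Finset.sum_congr rfl fun r _ => Finset.sum_comm

theorem partialContract_sub (W : Matrix b b ℂ) (X Y : Matrix (a × b) (a × b) ℂ) :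
    partialContract W (X - Y) = partialContract W X - partialContract W Y := by
  ext i j
  simp [partialContract, mul_sub]

theorem partialContract_smul (W : Matrix b b ℂ) (c : ℝ) (X : Matrix (a × b) (a × b) ℂ) :
    partialContract W (c • X) = c • partialContract W X := by
  ext i j
  simp only [partialContract, of_apply, Matrix.smul_apply, Finset.smul_sum, mul_smul_comm]

theorem partialContract_kronecker (W B : Matrix b b ℂ) (A : Matrix a a ℂ) :
    partialContract W (A ⊗ₖ B) = (W * B).trace • A := by
  ext i j
  simp only [partialContract, of_apply, kroneckerMap_apply, Matrix.smul_apply, Matrix.trace, diag_apply,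
    mul_apply, smul_eq_mul, Finset.sum_mul]
  exact Finset.sum_congr rfl fun r _ => Finset.sum_congr rfl fun s _ => by ring

theorem trace_partialContract (W : Matrix b b ℂ) (X : Matrix (a × b) (a × b) ℂ) :
    (partialContract W X).trace = (W * trFst X).trace := by
  simp only [partialContract, trFst, of_apply, Matrix.trace, diag_apply, mul_apply, Finset.mul_sum]
  rw [Finset.sum_comm]
  refine Finset.sum_congr rfl fun r _ => ?_
  rw [Finset.sum_comm]

theorem trace_trSnd (X : Matrix (a × b) (a × b) ℂ) : (trSnd X).trace = X.trace := by
  simp [trSnd, Matrix.trace, Fintype.sum_prod_type]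

theorem trace_trFst (X : Matrix (a × b) (a × b) ℂ) : (trFst X).trace = X.trace := by
  simp [trFst, Matrix.trace, Fintype.sum_prod_type_right]

theorem posSemidef_trSnd {X : Matrix (a × b) (a × b) ℂ} (hX : X.PosSemidef) :
    (trSnd X).PosSemidef := by
  classical
  rw [← partialContract_one]
  exact posSemidef_partialContract PosSemidef.one hX

theorem posSemidef_trFst {X : Matrix (a × b) (a × b) ℂ} (hX : X.PosSemidef) :
    (trFst X).PosSemidef :=
  posSemidef_trSnd (hX.submatrix (Prod.swap : b × a → a × b))

theorem trace_re_nonneg {X : Matrix a a ℂ} (hX : X.PosSemidef) : 0 ≤ X.trace.re :=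
  (Complex.nonneg_iff.1 hX.trace_nonneg).1

theorem trace_eq_re {X : Matrix a a ℂ} (hX : X.PosSemidef) :
    X.trace = (X.trace.re : ℂ) :=
  Complex.ext rfl (Complex.nonneg_iff.1 hX.trace_nonneg).2.symm

end Contraction

variable {L P Z : Type} [Fintype L] [DecidableEq L] [Fintype P] [DecidableEq P] [Fintype Z]

theorem measuredBlock_eq_partialContract (E : Matrix (L × P) (L × P) ℂ)
    (ζ : Matrix ((L × P) × (L × P)) ((L × P) × (L × P)) ℂ) :
    measuredBlock E ζ = partialContract E ζ := by
  ext i j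
  simp [measuredBlock, trSnd, partialContract, mul_apply, Fintype.sum_prod_type, one_apply,
    ite_mul]

theorem contract_eq_partialContract {k : ℕ} (w : Fin k → Matrix (L × P) (L × P) ℂ)
    (ρ : ExtOp L P (k + 1)) :
    contract w ρ = partialContract (piTensor w)
      (ρ.submatrix (fun q : ((L × P) × (L × P)) × (Fin k → L × P) =>
        (q.1.1, Fin.cons (α := fun _ => L × P) q.1.2 q.2)) (fun q =>
        (q.1.1, Fin.cons (α := fun _ => L × P) q.1.2 q.2))) := rfl

theorem posSemidef_contract {k : ℕ} {w : Fin k → Matrix (L × P) (L × P) ℂ}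
    (hw : ∀ t, (w t).PosSemidef) {ρ : ExtOp L P (k + 1)} (hρ : ρ.PosSemidef) :
    (contract w ρ).PosSemidef := by
  rw [contract_eq_partialContract]
  exact posSemidef_partialContract (posSemidef_piTensor hw) (hρ.submatrix _)

/-- A sum over functions on `Fin (k + 1)` splits off the value at `0`. -/
theorem sum_fin_cons {k : ℕ} {α : Type} [Fintype α] {M : Type} [AddCommMonoid M]
    (f : (Fin (k + 1) → α) → M) :
    ∑ r, f r = ∑ x, ∑ s : Fin k → α, f (Fin.cons (α := fun _ => α) x s) := by
  rw [← Fintype.sum_prod_type' (f := fun x s => f (Fin.cons (α := fun _ => α) x s))]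
  exact (Fintype.sum_equiv (Fin.consEquiv fun _ : Fin (k + 1) => α) _ _ fun _ => rfl).symm

theorem partialContract_contract {k : ℕ} (E : Matrix (L × P) (L × P) ℂ)
    (w : Fin k → Matrix (L × P) (L × P) ℂ) (ρ : ExtOp L P (k + 1)) :
    partialContract E (contract w ρ) = partialContract
      (piTensor (Fin.cons (α := fun _ => Matrix (L × P) (L × P) ℂ) E w)) ρ := by
  ext i j
  simp only [partialContract, contract, piTensor, of_apply, sum_fin_cons (k := k) (α := L × P),
    Fin.prod_univ_succ, Fin.cons_zero, Fin.cons_succ, Finset.mul_sum]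
  refine Finset.sum_congr rfl fun x _ => ?_
  rw [Finset.sum_comm]
  refine Finset.sum_congr rfl fun r _ => Finset.sum_congr rfl fun y _ =>
    Finset.sum_congr rfl fun s _ => ?_
  ring

theorem partialContract_piTensor_perm {k : ℕ} {ρ : ExtOp L P (k + 1)} (hρ : IsFeasibleExt ρ)
    (v : Fin (k + 1) → Matrix (L × P) (L × P) ℂ) (π : Equiv.Perm (Fin (k + 1))) :
    partialContract (piTensor (v ∘ π)) ρ = partialContract (piTensor v) ρ := by
  ext i j
  simp only [partialContract, piTensor, of_apply]
  have hsub : ∀ r s, ρ (i, s ∘ π) (j, r ∘ π) = ρ (i, s) (j, r) := fun r s =>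
    congrFun (congrFun (hρ.symm π) (i, s)) (j, r)
  symm
  refine Fintype.sum_equiv (Equiv.arrowCongr π.symm (Equiv.refl _)) _ _ fun r => ?_
  refine Fintype.sum_equiv (Equiv.arrowCongr π.symm (Equiv.refl _)) _ _ fun s => ?_
  have h : ∀ r : Fin (k + 1) → L × P,
      (Equiv.arrowCongr π.symm (Equiv.refl (L × P))) r = r ∘ π := fun r => rfl
  rw [h, h, hsub]
  congr 1
  exact (Equiv.prod_comp π fun t => v t (r t) (s t)).symm

/-- The effects on all copies when the first `m` ones are measured with outcomes `z`. -/
def outcomeEffects (M : Z → Matrix (L × P) (L × P) ℂ) (k : ℕ) {m : ℕ} (z : Fin m → Z) :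
    Fin k → Matrix (L × P) (L × P) ℂ :=
  fun t => if h : t.1 < m then M (z ⟨t.1, h⟩) else 1

theorem posSemidef_outcomeEffects {M : Z → Matrix (L × P) (L × P) ℂ} (hM : IsMeasurement M)
    {k m : ℕ} (z : Fin m → Z) (t : Fin k) : (outcomeEffects M k z t).PosSemidef := by
  rw [outcomeEffects]
  split_ifs with h
  · exact hM.1 _
  · exact PosSemidef.one

theorem postMeas_eq (M : Z → Matrix (L × P) (L × P) ℂ) {k : ℕ} (ρ : ExtOp L P (k + 1)) {m : ℕ}
    (z : Fin m → Z) : postMeas M ρ z = contract (outcomeEffects M k z) ρ := rfl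

theorem posSemidef_postMeas {M : Z → Matrix (L × P) (L × P) ℂ} (hM : IsMeasurement M) {k : ℕ}
    {ρ : ExtOp L P (k + 1)} (hρ : ρ.PosSemidef) {m : ℕ} (z : Fin m → Z) :
    (postMeas M ρ z).PosSemidef :=
  posSemidef_contract (posSemidef_outcomeEffects hM z) hρ

theorem cons_outcomeEffects (M : Z → Matrix (L × P) (L × P) ℂ) (k : ℕ) {m : ℕ} (x : Z)
    (z : Fin m → Z) :
    Fin.cons (α := fun _ => Matrix (L × P) (L × P) ℂ) (M x) (outcomeEffects M k z) =
      outcomeEffects M (k + 1) (Fin.cons (α := fun _ => Z) x z) := by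
  funext t
  refine Fin.cases ?_ (fun t => ?_) t
  · simp [outcomeEffects]
  · simp only [Fin.cons_succ, outcomeEffects, Fin.val_succ, Nat.add_lt_add_iff_right]
    split_ifs with h
    · rfl
    · rfl

theorem cons_one_outcomeEffects (M : Z → Matrix (L × P) (L × P) ℂ) {k m : ℕ} (hm : m ≤ k)
    (z : Fin m → Z) :
    Fin.cons (α := fun _ => Matrix (L × P) (L × P) ℂ) 1 (outcomeEffects M k z) =
      outcomeEffects M (k + 1) z ∘ (finRotate (k + 1)).symm := by
  -- the unmeasured first copy becomes the last one, which is unmeasured as `m ≤ k`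
  rw [Equiv.eq_comp_symm]
  funext t
  refine Fin.lastCases ?_ (fun t => ?_) t
  · simp [outcomeEffects, hm]
  · simp [outcomeEffects, Fin.val_castSucc]

/-- The operator on `LP` when the first `m` copies are measured with outcomes `z`. -/
def measuredLP (M : Z → Matrix (L × P) (L × P) ℂ) {k : ℕ} (ρ : ExtOp L P (k + 1)) {m : ℕ}
    (z : Fin m → Z) : Matrix (L × P) (L × P) ℂ :=
  partialContract (piTensor (outcomeEffects M (k + 1) z)) ρ

theorem posSemidef_measuredLP {M : Z → Matrix (L × P) (L × P) ℂ} (hM : IsMeasurement M) {k : ℕ}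
    {ρ : ExtOp L P (k + 1)} (hρ : ρ.PosSemidef) {m : ℕ} (z : Fin m → Z) :
    (measuredLP M ρ z).PosSemidef :=
  posSemidef_partialContract (posSemidef_piTensor (posSemidef_outcomeEffects hM z)) hρ

theorem partialContract_postMeas (M : Z → Matrix (L × P) (L × P) ℂ) {k : ℕ}
    (ρ : ExtOp L P (k + 1)) {m : ℕ} (x : Z) (z : Fin m → Z) :
    partialContract (M x) (postMeas M ρ z) =
      measuredLP M ρ (Fin.cons (α := fun _ => Z) x z) := by
  rw [postMeas_eq, partialContract_contract, cons_outcomeEffects, measuredLP]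

theorem trSnd_postMeas (M : Z → Matrix (L × P) (L × P) ℂ) {k : ℕ} {ρ : ExtOp L P (k + 1)}
    (hρ : IsFeasibleExt ρ) {m : ℕ} (hm : m ≤ k) (z : Fin m → Z) :
    trSnd (postMeas M ρ z) = measuredLP M ρ z := by
  rw [← partialContract_one, postMeas_eq, partialContract_contract, cons_one_outcomeEffects M hm,
    partialContract_piTensor_perm hρ, measuredLP]

theorem sum_piTensor_outcomeEffects {M : Z → Matrix (L × P) (L × P) ℂ} (hM : IsMeasurement M)
    {k m : ℕ} (hm : m ≤ k) :
    ∑ z : Fin m → Z, piTensor (outcomeEffects M k z) = 1 := by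
  obtain ⟨l, rfl⟩ := Nat.exists_eq_add_of_le hm
  rw [← piTensor_one]
  ext r s
  simp only [Matrix.sum_apply, piTensor, of_apply, Fin.prod_univ_add]
  simp only [outcomeEffects, Fin.val_castAdd, Fin.is_lt, dite_true, Fin.val_natAdd,
    Fin.eta, not_lt.2 (Nat.le_add_right m _), dite_false]
  rw [← Finset.sum_mul]
  congr 1
  rw [← Fintype.piFinset_univ, ← Finset.prod_univ_sum
    (fun _ => Finset.univ) (fun (i : Fin m) (x : Z) => M x (r (Fin.castAdd l i))
      (s (Fin.castAdd l i)))]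
  refine Finset.prod_congr rfl fun i _ => ?_
  rw [← hM.2, Matrix.sum_apply]

theorem reduced_eq_contract {k : ℕ} (ρ : ExtOp L P (k + 1)) :
    reduced ρ = contract (fun _ => 1) ρ := by
  rw [contract_eq_partialContract, piTensor_one, partialContract_one]
  rfl

theorem sum_postMeas {M : Z → Matrix (L × P) (L × P) ℂ} (hM : IsMeasurement M) {k m : ℕ}
    (hm : m ≤ k) (ρ : ExtOp L P (k + 1)) :
    ∑ z : Fin m → Z, postMeas M ρ z = reduced ρ := by
  simp only [postMeas_eq, reduced_eq_contract, contract_eq_partialContract]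
  rw [← partialContract_sum, sum_piTensor_outcomeEffects hM hm, piTensor_one]

theorem trace_reduced {k : ℕ} (ρ : ExtOp L P (k + 1)) : (reduced ρ).trace = ρ.trace := by
  simp only [reduced, Matrix.trace, diag_apply, of_apply, Fintype.sum_prod_type, sum_fin_cons]

/-! ### Conditioning on measured copies decouples `LP` from the first copy -/

section Measured

variable {M : Z → Matrix (L × P) (L × P) ℂ} {k : ℕ} {ρ : ExtOp L P (k + 1)}

theorem prob_nonneg (hM : IsMeasurement M) (hρ : IsFeasibleExt ρ) {m : ℕ} (z : Fin m → Z) :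
    0 ≤ prob M ρ z :=
  trace_re_nonneg (posSemidef_postMeas hM hρ.state.1 z)

theorem sum_prob (hM : IsMeasurement M) (hρ : IsFeasibleExt ρ) {m : ℕ} (hm : m ≤ k) :
    ∑ z : Fin m → Z, prob M ρ z = 1 := by
  simp only [prob]
  rw [← Complex.re_sum, ← trace_sum, sum_postMeas hM hm, trace_reduced, hρ.state.2]
  rfl

/-- The conditional correlation `p(z) (ρ_{LP L̄P̄ | z} - ρ_{LP | z} ⊗ ρ_{L̄P̄ | z})`. -/
noncomputable def condCorrelation (M : Z → Matrix (L × P) (L × P) ℂ) {k : ℕ}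
    (ρ : ExtOp L P (k + 1)) {m : ℕ} (z : Fin m → Z) :
    Matrix ((L × P) × (L × P)) ((L × P) × (L × P)) ℂ :=
  postMeas M ρ z - prob M ρ z • (condLP M ρ z ⊗ₖ condBar M ρ z)

theorem smul_condLP_kronecker_condBar {m : ℕ} (z : Fin m → Z) :
    prob M ρ z • (condLP M ρ z ⊗ₖ condBar M ρ z) =
      (prob M ρ z)⁻¹ • (trSnd (postMeas M ρ z) ⊗ₖ trFst (postMeas M ρ z)) := by
  rw [condLP, condBar, smul_kronecker, kronecker_smul, smul_smul, smul_smul]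
  congr 1
  by_cases h : prob M ρ z = 0
  · simp [h]
  · field_simp

theorem reduced_sub_rounded (hM : IsMeasurement M) {m : ℕ} (hm : m ≤ k) :
    reduced ρ - rounded M ρ m = ∑ z : Fin m → Z, condCorrelation M ρ z := by
  simp only [condCorrelation, Finset.sum_sub_distrib, sum_postMeas hM hm, rounded]

theorem isHermitian_condCorrelation (hM : IsMeasurement M) (hρ : IsFeasibleExt ρ) {m : ℕ}
    (z : Fin m → Z) : (condCorrelation M ρ z).IsHermitian := by
  have h := posSemidef_postMeas hM hρ.state.1 z
  rw [condCorrelation, smul_condLP_kronecker_condBar]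
  refine h.isHermitian.sub ?_
  rw [IsHermitian, conjTranspose_smul, conjTranspose_kronecker,
    (posSemidef_trSnd h).isHermitian.eq, (posSemidef_trFst h).isHermitian.eq]
  simp

theorem measuredBlock_condCorrelation (hM : IsMeasurement M) (hρ : IsFeasibleExt ρ) {m : ℕ}
    (hm : m ≤ k) (z : Fin m → Z) (x : Z) :
    measuredBlock (M x) (condCorrelation M ρ z) =
      measuredLP M ρ (Fin.cons (α := fun _ => Z) x z) -
        ((measuredLP M ρ (Fin.cons (α := fun _ => Z) x z)).trace.re /
          (measuredLP M ρ z).trace.re) • measuredLP M ρ z := by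
  have hx := posSemidef_measuredLP hM hρ.state.1 (Fin.cons (α := fun _ => Z) x z)
  rw [measuredBlock_eq_partialContract, condCorrelation, smul_condLP_kronecker_condBar,
    partialContract_sub, partialContract_smul, partialContract_kronecker,
    ← trace_partialContract, partialContract_postMeas, trSnd_postMeas M hρ hm, prob,
    ← trace_trSnd, trSnd_postMeas M hρ hm, div_eq_inv_mul, mul_smul]
  congr 2
  conv_lhs => rw [trace_eq_re hx]
  ext i j
  simp

theorem sum_measuredLP_cons (hM : IsMeasurement M) (hρ : IsFeasibleExt ρ) {m : ℕ}
    (hm : m ≤ k) (z : Fin m → Z) :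
    ∑ x, measuredLP M ρ (Fin.cons (α := fun _ => Z) x z) = measuredLP M ρ z := by
  simp only [← partialContract_postMeas]
  rw [← partialContract_sum, hM.2, partialContract_one, trSnd_postMeas M hρ hm]

theorem sum_trace_measuredLP (hM : IsMeasurement M) (hρ : IsFeasibleExt ρ) {m : ℕ}
    (hm : m ≤ k) :
    ∑ z : Fin m → Z, (measuredLP M ρ z).trace.re = 1 := by
  rw [← sum_prob hM hρ hm]
  exact Finset.sum_congr rfl fun z _ => by
    rw [prob, ← trSnd_postMeas M hρ hm, trace_trSnd]

/-- One step of the chain rule, by Pinsker's and the Cauchy-Schwarz inequality: the measured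
conditional correlations are bounded by the decrease of the conditional entropy of `LP` when one more
copy is measured. -/
theorem sum_traceNorm_sq_le (hM : IsMeasurement M) (hρ : IsFeasibleExt ρ) {m : ℕ} (hm : m ≤ k) :
    (∑ z : Fin m → Z, ∑ x, traceNorm (measuredBlock (M x) (condCorrelation M ρ z))) ^ 2 ≤
      2 * (∑ z : Fin m → Z, condEntropy (measuredLP M ρ z) -
        ∑ z : Fin (m + 1) → Z, condEntropy (measuredLP M ρ z)) := by
  have hpos := fun (z : Fin m → Z) (x : Z) =>
    posSemidef_measuredLP hM hρ.state.1 (Fin.cons (α := fun _ => Z) x z)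
  choose D hD0 hD hDsum using fun z : Fin m → Z => exists_relEntropy
    (fun x => measuredLP M ρ (Fin.cons (α := fun _ => Z) x z)) (hpos z)
  simp only [sum_measuredLP_cons hM hρ hm] at hD hDsum
  have htot : ∑ q : (Fin m → Z) × Z,
      (measuredLP M ρ (Fin.cons (α := fun _ => Z) q.2 q.1)).trace.re = 1 := by
    rw [Fintype.sum_prod_type, ← sum_trace_measuredLP hM hρ hm]
    refine Finset.sum_congr rfl fun z _ => ?_
    rw [← sum_measuredLP_cons hM hρ hm, trace_sum, Complex.re_sum]
  have hDtot : ∑ q : (Fin m → Z) × Z, 2 * D q.1 q.2 =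
      2 * (∑ z : Fin m → Z, condEntropy (measuredLP M ρ z) -
        ∑ z : Fin (m + 1) → Z, condEntropy (measuredLP M ρ z)) := by
    rw [← Finset.mul_sum, Fintype.sum_prod_type, sum_fin_cons, Finset.sum_comm (s := Finset.univ)
      (t := Finset.univ) (f := fun x s => condEntropy (measuredLP M ρ
        (Fin.cons (α := fun _ => Z) x s))), ← Finset.sum_sub_distrib]
    simp only [hDsum]
  rw [← Fintype.sum_prod_type' (f := fun z x =>
    traceNorm (measuredBlock (M x) (condCorrelation M ρ z))), ← hDtot]
  refine (Finset.sum_sq_le_sum_mul_sum_of_sq_le_mul _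
    (f := fun q : (Fin m → Z) × Z => (measuredLP M ρ (Fin.cons (α := fun _ => Z) q.2 q.1)).trace.re)
    (g := fun q => 2 * D q.1 q.2) (fun q _ => trace_re_nonneg (hpos _ _))
    (fun q _ => mul_nonneg zero_le_two (hD0 _ _)) fun q _ => ?_).trans (le_of_eq ?_)
  · rw [measuredBlock_condCorrelation hM hρ hm]
    refine (hD q.1 q.2).trans (le_of_eq ?_)
    ring
  · rw [htot, one_mul]

/-- The conditional entropies of `LP` telescope, so that for some `m ≤ k` measuring `m` copies leaves
little correlation. -/
theorem exists_sum_traceNorm_le (hM : IsMeasurement M) (hρ : IsFeasibleExt ρ) :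
    ∃ m ≤ k, ∑ z : Fin m → Z, ∑ x, traceNorm (measuredBlock (M x) (condCorrelation M ρ z)) ≤
      Real.sqrt (2 * Real.log ((Fintype.card L : ℝ) * Fintype.card P) / ((k : ℝ) + 1)) := by
  set H : ℕ → ℝ := fun m => ∑ z : Fin m → Z, condEntropy (measuredLP M ρ z) with hH
  set l : ℝ := Real.log ((Fintype.card L : ℝ) * Fintype.card P) with hl
  have h0 : H 0 ≤ l := by
    have h1 := sum_trace_measuredLP hM hρ (Nat.zero_le k)
    have hpos := fun z : Fin 0 → Z => posSemidef_measuredLP hM hρ.state.1 z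
    simp only [Finset.univ_unique, Finset.sum_singleton] at h1
    simp only [hH, Finset.univ_unique, Finset.sum_singleton]
    refine (condEntropy_le_log_card (hpos _) ?_).trans (le_of_eq ?_)
    · rw [trace_eq_re (hpos _), h1, Complex.ofReal_one]
    · rw [Fintype.card_prod, Nat.cast_mul]
  have hk : 0 ≤ H (k + 1) :=
    Finset.sum_nonneg fun z _ => condEntropy_nonneg (posSemidef_measuredLP hM hρ.state.1 z)
  have hex : ∃ m ∈ Finset.range (k + 1), H m - H (m + 1) ≤ l / ((k : ℝ) + 1) := by
    refine Finset.exists_le_of_sum_le ⟨0, by simp⟩ ?_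
    rw [Finset.sum_range_sub', Finset.sum_const, Finset.card_range, nsmul_eq_mul]
    push_cast
    rw [mul_div_cancel₀ _ (by positivity)]
    linarith
  obtain ⟨m, hm, hle⟩ := hex
  have hmk : m ≤ k := Nat.lt_succ_iff.1 (Finset.mem_range.1 hm)
  refine ⟨m, hmk, Real.le_sqrt_of_sq_le ((sum_traceNorm_sq_le hM hρ hmk).trans ?_)⟩
  rw [mul_div_assoc]
  exact mul_le_mul_of_nonneg_left hle zero_le_two

theorem IsInfoComplete.nonneg [Nonempty L] [Nonempty P] {c : ℝ} (hc : IsInfoComplete M c) :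
    0 ≤ c := by
  by_contra hneg
  -- the identity has positive trace norm
  have h := hc 1 isHermitian_one
  have h1 : IsDiagonalization (1 : Matrix ((L × P) × (L × P)) ((L × P) × (L × P)) ℂ) 1
      (fun _ => 1) := ⟨by simp, by simp, by simp⟩
  have h2 : 0 < traceNorm (1 : Matrix ((L × P) × (L × P)) ((L × P) × (L × P)) ℂ) := by
    rw [h1.traceNorm_eq]
    simp only [abs_one, Finset.sum_const, Finset.card_univ, nsmul_eq_mul, mul_one, Nat.cast_pos]
    exact Fintype.card_pos
  have h3 : 0 ≤ ∑ z, traceNorm (measuredBlock (M z) 1) :=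
    Finset.sum_nonneg fun _ _ => traceNorm_nonneg _
  nlinarith [not_le.1 hneg]

theorem objective_sub (N : Matrix P P ℂ →ₗ[ℂ] Matrix P P ℂ)
    (ω ω' : Matrix ((L × P) × (L × P)) ((L × P) × (L × P)) ℂ) :
    objective N ω - objective N ω' = objective N (ω - ω') := by
  rw [objective, objective, objective, Matrix.mul_sub, trace_sub, Complex.sub_re, mul_sub]

/-- The rounding error of the hierarchy. -/
theorem exists_objective_reduced_sub_rounded_le [Nonempty L] [Nonempty P] (hM : IsMeasurement M)
    {c : ℝ} (hc : IsInfoComplete M c) (N : Matrix P P ℂ →ₗ[ℂ] Matrix P P ℂ)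
    (hρ : IsFeasibleExt ρ) :
    ∃ m ≤ k, objective N (reduced ρ) - objective N (rounded M ρ m) ≤
      (Fintype.card P : ℝ) ^ 2 * opNorm (choiIdTensor L N) * c *
        Real.sqrt (2 * Real.log ((Fintype.card L : ℝ) * Fintype.card P) / ((k : ℝ) + 1)) := by
  obtain ⟨m, hm, hle⟩ := exists_sum_traceNorm_le hM hρ
  refine ⟨m, hm, ?_⟩
  have hterm : ∀ z : Fin m → Z, ((choiIdTensor L N * condCorrelation M ρ z).trace).re ≤
      opNorm (choiIdTensor L N) *
        (c * ∑ x, traceNorm (measuredBlock (M x) (condCorrelation M ρ z))) := fun z =>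
    (Complex.re_le_norm _).trans <|
      (norm_trace_mul_le _ (isHermitian_condCorrelation hM hρ z)).trans <|
        mul_le_mul_of_nonneg_left (hc _ (isHermitian_condCorrelation hM hρ z)) (opNorm_nonneg _)
  rw [objective_sub, reduced_sub_rounded hM hm, objective, Finset.mul_sum, trace_sum,
    Complex.re_sum, mul_assoc, mul_assoc]
  refine mul_le_mul_of_nonneg_left ?_ (by positivity)
  refine (Finset.sum_le_sum fun z _ => hterm z).trans ?_
  rw [← Finset.mul_sum, ← Finset.mul_sum]
  exact mul_le_mul_of_nonneg_left (mul_le_mul_of_nonneg_left hle hc.nonneg) (opNorm_nonneg _)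

/-! ### The rounded point is feasible -/

theorem trFst_partialContract {k : ℕ} {ρ : ExtOp L P (k + 1)} (hρ : IsFeasibleExt ρ)
    (W : Matrix (Fin (k + 1) → L × P) (Fin (k + 1) → L × P) ℂ) :
    trFst (partialContract W ρ) = (W * trFst ρ).trace • maxMixed P := by
  rw [← partialContract_kronecker, ← hρ.decoder]
  ext i j
  simp only [trFst, partialContract, of_apply, trL, Finset.mul_sum]
  rw [Finset.sum_comm]
  refine Finset.sum_congr rfl fun r _ => ?_
  rw [Finset.sum_comm]

theorem trSnd_trFst_contract {k : ℕ} {ρ : ExtOp L P (k + 1)} (hρ : IsFeasibleExt ρ)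
    (w : Fin k → Matrix (L × P) (L × P) ℂ) :
    trSnd (trFst (contract w ρ)) =
      (piTensor w * trLast (trFst ρ)).trace • maxMixed L := by
  -- the first copy of `L̄P̄` is exchanged with the last one
  have hperm : ∀ (i j : L × P) (r s : Fin k → L × P),
      trFst ρ (Fin.cons (α := fun _ => L × P) i s) (Fin.cons (α := fun _ => L × P) j r) =
        trFst ρ (Fin.snoc (α := fun _ => L × P) s i) (Fin.snoc (α := fun _ => L × P) r j) := by
    intro i j r s
    have hcs : ∀ (i : L × P) (s : Fin k → L × P), Fin.snoc (α := fun _ => L × P) s i =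
        Fin.cons (α := fun _ => L × P) i s ∘ finRotate (k + 1) := by
      intro i s
      funext t
      refine Fin.lastCases ?_ (fun t => ?_) t <;> simp
    rw [hcs, hcs]
    simp only [trFst, of_apply]
    refine Finset.sum_congr rfl fun y _ => ?_
    exact (congrFun (congrFun (hρ.symm (finRotate (k + 1)))
      (y, Fin.cons (α := fun _ => L × P) i s)) (y, Fin.cons (α := fun _ => L × P) j r)).symm
  have hfst : ∀ i j, trFst (contract w ρ) i j = ∑ r, ∑ s, piTensor w r s *
      trFst ρ (Fin.snoc (α := fun _ => L × P) s i) (Fin.snoc (α := fun _ => L × P) r j) := by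
    intro i j
    simp only [← hperm]
    simp only [trFst, contract, of_apply, piTensor, Finset.mul_sum]
    rw [Finset.sum_comm]
    refine Finset.sum_congr rfl fun r _ => ?_
    rw [Finset.sum_comm]
  ext l l'
  have henc : ∀ r s, ∑ p, trFst ρ (Fin.snoc (α := fun _ => L × P) s (l, p))
      (Fin.snoc (α := fun _ => L × P) r (l', p)) = trLast (trFst ρ) s r * maxMixed L l l' :=
    fun r s => congrFun (congrFun hρ.encoder (s, l)) (r, l')
  have hstep : trSnd (trFst (contract w ρ)) l l' = ∑ p, trFst (contract w ρ) (l, p) (l', p) := rfl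
  rw [hstep]
  simp only [hfst]
  rw [Finset.sum_comm, Matrix.smul_apply, Matrix.trace, smul_eq_mul, Finset.sum_mul]
  refine Finset.sum_congr rfl fun r _ => ?_
  rw [Finset.sum_comm, diag_apply, mul_apply, Finset.sum_mul]
  refine Finset.sum_congr rfl fun s _ => ?_
  rw [← Finset.mul_sum, henc, mul_assoc]

theorem trace_maxMixed (a : Type) [Fintype a] [DecidableEq a] [Nonempty a] :
    (maxMixed a).trace = 1 := by
  rw [maxMixed, trace_smul, trace_one, smul_eq_mul, inv_mul_cancel₀]
  exact_mod_cast Fintype.card_ne_zero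

theorem rounded_mem_SigmaProd [Nonempty L] [Nonempty P] (hM : IsMeasurement M)
    (hρ : IsFeasibleExt ρ) {m : ℕ} (hm : m ≤ k) : rounded M ρ m ∈ SigmaProd L P := by
  classical
  have hprod : ∀ z : Fin m → Z, prob M ρ z ≠ 0 →
      condLP M ρ z ⊗ₖ condBar M ρ z ∈ SigmaProd L P := by
    intro z hz
    have hT := posSemidef_postMeas hM hρ.state.1 z
    have hp := prob_nonneg hM hρ z
    have htr : (postMeas M ρ z).trace = (prob M ρ z : ℂ) := trace_eq_re hT
    have hcancel : (prob M ρ z)⁻¹ • (prob M ρ z : ℂ) = 1 := by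
      rw [Complex.real_smul, ← Complex.ofReal_mul, inv_mul_cancel₀ hz, Complex.ofReal_one]
    have hscale : ∀ {b : Type} [Fintype b] [DecidableEq b] [Nonempty b] {X : Matrix b b ℂ},
        X.trace = (prob M ρ z : ℂ) → (∃ c : ℂ, X = c • maxMixed b) →
          (prob M ρ z)⁻¹ • X = maxMixed b := by
      rintro b _ _ _ X h1 ⟨c, h2⟩
      rw [h2, trace_smul, trace_maxMixed, smul_eq_mul, mul_one] at h1
      rw [h2, h1, ← smul_assoc, hcancel, one_smul]
    refine subset_convexHull ℝ _ ⟨_, _, ⟨?_, ?_⟩, ⟨?_, ?_⟩, ?_, ?_, rfl⟩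
    · exact (posSemidef_trSnd hT).smul (inv_nonneg.2 hp)
    · rw [condLP, trace_smul, trace_trSnd, htr, hcancel]
    · exact (posSemidef_trFst hT).smul (inv_nonneg.2 hp)
    · rw [condBar, trace_smul, trace_trFst, htr, hcancel]
    · have h1 : trFst (condLP M ρ z) = (prob M ρ z)⁻¹ • trFst (trSnd (postMeas M ρ z)) := by
        ext i j
        simp [condLP, trFst, Finset.mul_sum]
      rw [h1]
      exact hscale (by rw [trace_trFst, trace_trSnd, htr])
        ⟨_, (congrArg trFst (trSnd_postMeas M hρ hm z)).trans (trFst_partialContract hρ _)⟩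
    · have h1 : trSnd (condBar M ρ z) = (prob M ρ z)⁻¹ • trSnd (trFst (postMeas M ρ z)) := by
        ext i j
        simp [condBar, trSnd, Finset.mul_sum]
      rw [h1]
      exact hscale (by rw [trace_trSnd, trace_trFst, htr])
        ⟨_, trSnd_trFst_contract hρ (outcomeEffects M k z)⟩
  have hfilter : rounded M ρ m = ∑ z ∈ Finset.univ.filter (fun z : Fin m → Z => prob M ρ z ≠ 0),
      prob M ρ z • (condLP M ρ z ⊗ₖ condBar M ρ z) := by
    rw [rounded, Finset.sum_filter_of_ne]
    intro z _ hz h0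
    exact hz (by rw [h0, zero_smul])
  rw [hfilter]
  refine (convex_convexHull ℝ _).sum_mem (fun z _ => prob_nonneg hM hρ z) ?_ fun z hz =>
    hprod z (Finset.mem_filter.1 hz).2
  rw [Finset.sum_filter_ne_zero, sum_prob hM hρ hm]

end Measured

/-! ### Product states are extendible -/

section Product

variable {ρ σ : Matrix (L × P) (L × P) ℂ}

theorem trace_piTensor {ι b : Type} [Fintype ι] [DecidableEq ι] [Fintype b]
    (w : ι → Matrix b b ℂ) : (piTensor w).trace = ∏ t, (w t).trace := by
  simp only [Matrix.trace, diag_apply, piTensor, of_apply]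
  rw [Finset.prod_univ_sum, Fintype.piFinset_univ]

theorem trFst_kronecker {a b : Type} [Fintype a] (A : Matrix a a ℂ) (B : Matrix b b ℂ) :
    trFst (A ⊗ₖ B) = A.trace • B := by
  ext i j
  simp [trFst, Matrix.trace, Finset.sum_mul]

/-- `ρ ⊗ σ^{⊗ n}` is feasible. -/
theorem isFeasibleExt_kronecker_piTensor (hρ : IsState ρ) (hσ : IsState σ)
    (hρP : trFst ρ = maxMixed P) (hσL : trSnd σ = maxMixed L) (k : ℕ) :
    IsFeasibleExt (k := k) (ρ ⊗ₖ piTensor fun _ : Fin (k + 1) => σ) := by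
  have htr : trFst (ρ ⊗ₖ piTensor fun _ : Fin (k + 1) => σ) = piTensor fun _ => σ := by
    rw [trFst_kronecker, hρ.2, one_smul]
  have hσL' : ∀ l l', ∑ p, σ (l, p) (l', p) = maxMixed L l l' := fun l l' =>
    congrFun (congrFun hσL l) l'
  have hσtr : ∑ x, σ x x = 1 := hσ.2
  constructor
  · refine ⟨hρ.1.kronecker (posSemidef_piTensor fun _ => hσ.1), ?_⟩
    rw [trace_kronecker, trace_piTensor, hρ.2, hσ.2]
    simp
  · intro π
    ext i j
    simp only [submatrix_apply, kroneckerMap_apply, piTensor, of_apply, Function.comp_apply]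
    rw [Equiv.prod_comp π fun t => σ (i.2 t) (j.2 t)]
  · rw [htr, ← hρP]
    ext i j
    simp [trL, trFst, Finset.sum_mul]
  · rw [htr]
    ext ⟨r, l⟩ ⟨s, l'⟩
    simp only [trLastP, trLast, piTensor, of_apply, kroneckerMap_apply, Fin.prod_univ_castSucc,
      Fin.snoc_castSucc, Fin.snoc_last, ← Finset.mul_sum, hσL', hσtr, mul_one]

theorem reduced_kronecker_piTensor (hσ : IsState σ) (k : ℕ) :
    reduced (k := k) (ρ ⊗ₖ piTensor fun _ : Fin (k + 1) => σ) = ρ ⊗ₖ σ := by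
  have h : ∑ r, (piTensor fun _ : Fin k => σ) r r = 1 := by
    have := trace_piTensor fun _ : Fin k => σ
    simp only [hσ.2, Finset.prod_const_one] at this
    exact this
  ext i j
  simp only [piTensor, of_apply] at h
  simp only [reduced, of_apply, kroneckerMap_apply, piTensor, Fin.prod_univ_succ, Fin.cons_zero,
    Fin.cons_succ, ← Finset.mul_sum, h, mul_one]

theorem kronecker_mem_SigmaProdLevel (hρ : IsState ρ) (hσ : IsState σ)
    (hρP : trFst ρ = maxMixed P) (hσL : trSnd σ = maxMixed L) (k : ℕ) :
    ρ ⊗ₖ σ ∈ SigmaProdLevel L P k :=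
  ⟨_, isFeasibleExt_kronecker_piTensor hρ hσ hρP hσL k, reduced_kronecker_piTensor hσ k⟩

end Product

/-! ### Channels and Choi matrices -/

theorem map_eq_sum_single {a b : Type} [Fintype a] [DecidableEq a]
    (Φ : Matrix a a ℂ →ₗ[ℂ] Matrix b b ℂ) (X : Matrix a a ℂ) :
    Φ X = ∑ x, ∑ x', X x x' • Φ (single x x' 1) := by
  conv_lhs => rw [matrix_eq_sum_single X]
  simp only [map_sum]
  refine Finset.sum_congr rfl fun x _ => Finset.sum_congr rfl fun x' _ => ?_
  rw [← map_smul, smul_single, smul_eq_mul, mul_one]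

theorem map_apply_eq_sum {a b : Type} [Fintype a] [DecidableEq a]
    (Φ : Matrix a a ℂ →ₗ[ℂ] Matrix b b ℂ) (X : Matrix a a ℂ) (y y' : b) :
    Φ X y y' = ∑ x, ∑ x', X x x' * Φ (single x x' 1) y y' := by
  rw [map_eq_sum_single]
  simp [Matrix.sum_apply]

theorem posSemidef_maxEntangled (a : Type) [Fintype a] [DecidableEq a] :
    (maxEntangled a).PosSemidef := by
  have h : maxEntangled a = (Fintype.card a : ℝ)⁻¹ • vecMulVec
      (fun i : a × a => if i.1 = i.2 then (1 : ℂ) else 0)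
      (star fun i : a × a => if i.1 = i.2 then (1 : ℂ) else 0) := by
    ext i j
    simp only [maxEntangled, of_apply, Matrix.smul_apply, vecMulVec_apply, Pi.star_apply,
      apply_ite star, star_one, star_zero]
    by_cases h1 : i.1 = i.2 <;> by_cases h2 : j.1 = j.2 <;> simp [h1, h2]
  rw [h]
  exact (posSemidef_vecMulVec_self_star _).smul (inv_nonneg.2 (Nat.cast_nonneg _))

section Choi

variable {n : ℕ} {b : Type} [Fintype b]

/-- The easy direction of Choi's theorem. -/
theorem posSemidef_choi {Φ : Matrix (Fin n) (Fin n) ℂ →ₗ[ℂ] Matrix b b ℂ} (hΦ : IsChannel Φ) :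
    (choi Φ).PosSemidef := by
  have h := (hΦ.1 n _ (posSemidef_maxEntangled (Fin n))).submatrix
    (Prod.swap : b × Fin n → Fin n × b)
  have h2 : choi Φ = (idTensor (Fin n) Φ (maxEntangled (Fin n))).submatrix Prod.swap Prod.swap := by
    ext i j
    have h3 : (of fun x y => maxEntangled (Fin n) (i.2, x) (j.2, y)) =
        (Fintype.card (Fin n) : ℂ)⁻¹ • single i.2 j.2 (1 : ℂ) := by
      ext x y
      simp [maxEntangled, single_apply]
    simp only [submatrix_apply, idTensor, LinearMap.coe_mk, AddHom.coe_mk, of_apply, choi,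
      Prod.fst_swap, Prod.snd_swap, h3, map_smul, Matrix.smul_apply, smul_eq_mul]
  rwa [h2]

theorem trFst_choi {Φ : Matrix (Fin n) (Fin n) ℂ →ₗ[ℂ] Matrix b b ℂ} (hΦ : IsChannel Φ) :
    trFst (choi Φ) = maxMixed (Fin n) := by
  ext x x'
  have h := hΦ.2 (single x x' 1)
  simp only [trFst, choi, of_apply, ← Finset.mul_sum, maxMixed, Matrix.smul_apply, smul_eq_mul]
  congr 1
  refine Eq.trans h ?_
  by_cases hx : x = x'
  · subst hx; simp
  · simp [hx, one_apply, trace_single_eq_of_ne]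

variable {a : Type} [Fintype a]

/-- The linear map with Choi matrix `R`. -/
noncomputable def ofChoi (R : Matrix (b × a) (b × a) ℂ) : Matrix a a ℂ →ₗ[ℂ] Matrix b b ℂ where
  toFun X := of fun y y' => (Fintype.card a : ℂ) * ∑ x, ∑ x', X x x' * R (y, x) (y', x')
  map_add' X Y := by
    ext y y'
    simp [add_mul, Finset.sum_add_distrib, mul_add]
  map_smul' c X := by
    ext y y'
    simp only [Matrix.smul_apply, of_apply, smul_eq_mul, RingHom.id_apply, Finset.mul_sum]
    exact Finset.sum_congr rfl fun x _ => Finset.sum_congr rfl fun x' _ => by ring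

theorem choi_ofChoi [DecidableEq a] [Nonempty a] (R : Matrix (b × a) (b × a) ℂ) :
    choi (ofChoi R) = R := by
  ext i j
  have hn : (Fintype.card a : ℂ) ≠ 0 := by exact_mod_cast Fintype.card_ne_zero
  simp only [choi, ofChoi, LinearMap.coe_mk, AddHom.coe_mk, of_apply]
  rw [inv_mul_cancel_left₀ hn]
  simp [single_apply, ite_and, ite_mul]

theorem isChannel_ofChoi [DecidableEq a] [Nonempty a] {R : Matrix (b × a) (b × a) ℂ}
    (hR : R.PosSemidef) (htr : trFst R = maxMixed a) : IsChannel (ofChoi R) := by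
  classical
  have hn : (Fintype.card a : ℂ) ≠ 0 := by exact_mod_cast Fintype.card_ne_zero
  refine ⟨fun k X hX => ?_, fun X => ?_⟩
  · set V : Matrix (Fin k × b) ((Fin k × a) × (b × a)) ℂ := of fun i q =>
      if i = (q.1.1, q.2.1) then (if q.1.2 = q.2.2 then 1 else 0) else 0 with hV
    have h : idTensor (Fin k) (ofChoi R) X = (Fintype.card a : ℝ) • (V * (X ⊗ₖ R) * Vᴴ) := by
      ext ⟨i, y⟩ ⟨j, y'⟩
      simp only [idTensor, ofChoi, LinearMap.coe_mk, AddHom.coe_mk, of_apply, Matrix.smul_apply,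
        Complex.real_smul, Complex.ofReal_natCast]
      congr 1
      simp only [hV, mul_apply, conjTranspose_apply, of_apply, kroneckerMap_apply,
        Fintype.sum_prod_type, Prod.mk.injEq, ite_and, apply_ite star, star_one, star_zero,
        ite_mul, mul_ite, one_mul, zero_mul, mul_one, mul_zero, Finset.sum_ite_irrel,
        Finset.sum_const_zero, Finset.sum_ite_eq, Finset.mem_univ, if_true]
      exact Finset.sum_comm
    rw [h]
    exact ((hX.kronecker hR).mul_mul_conjTranspose_same V).smul (Nat.cast_nonneg _)
  · have htr' : ∀ x x', ∑ y, R (y, x) (y, x') = maxMixed a x x' := fun x x' =>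
      congrFun (congrFun htr x) x'
    simp only [ofChoi, LinearMap.coe_mk, AddHom.coe_mk, Matrix.trace, diag_apply, of_apply]
    rw [← Finset.mul_sum, Finset.sum_comm]
    have : ∀ x, ∑ y, ∑ x', X x x' * R (y, x) (y, x') = (Fintype.card a : ℂ)⁻¹ * X x x := by
      intro x
      rw [Finset.sum_comm]
      simp only [← Finset.mul_sum, htr', maxMixed, Matrix.smul_apply, one_apply, smul_eq_mul,
        mul_ite, mul_one, mul_zero, Finset.sum_ite_eq, Finset.mem_univ, if_true]
      ring
    simp only [this]
    rw [← Finset.mul_sum, mul_inv_cancel_left₀ hn]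

end Choi

/-! ### The code fidelity as a bilinear function of the Choi matrices -/

theorem choiIdTensor_apply (N : Matrix P P ℂ →ₗ[ℂ] Matrix P P ℂ) (i j : (L × P) × (L × P)) :
    choiIdTensor L N i j = ((Fintype.card L : ℂ) * Fintype.card P)⁻¹ *
      if i.1.1 = i.2.1 then (if j.1.1 = j.2.1 then N (single i.2.2 j.2.2 1) i.1.2 j.1.2 else 0)
      else 0 := by
  have h : (of fun x y => (single i.2 j.2 (1 : ℂ) : Matrix (L × P) (L × P) ℂ) (i.1.1, x)
      (j.1.1, y)) = if i.1.1 = i.2.1 then (if j.1.1 = j.2.1 then single i.2.2 j.2.2 (1 : ℂ) else 0)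
        else 0 := by
    ext x y
    by_cases h1 : i.1.1 = i.2.1 <;> by_cases h2 : j.1.1 = j.2.1 <;>
      simp [h1, h2, single_apply, Prod.ext_iff, eq_comm]
  simp only [choiIdTensor, choi, of_apply, idTensor, LinearMap.coe_mk, AddHom.coe_mk, h,
    Fintype.card_prod, Nat.cast_mul]
  congr 1
  split_ifs <;> simp

theorem trace_choiIdTensor_mul_kronecker (N : Matrix P P ℂ →ₗ[ℂ] Matrix P P ℂ)
    (A B : Matrix (L × P) (L × P) ℂ) :
    (choiIdTensor L N * (A ⊗ₖ B)).trace = ((Fintype.card L : ℂ) * Fintype.card P)⁻¹ *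
      ∑ l, ∑ l', ∑ q, ∑ q', ∑ p, ∑ p', N (single q q' 1) p p' * A (l', p') (l, p) *
        B (l', q') (l, q) := by
  simp only [Matrix.trace, diag_apply, mul_apply, choiIdTensor_apply, kroneckerMap_apply, mul_assoc,
    ← Finset.mul_sum]
  congr 1
  simp only [Fintype.sum_prod_type, ite_mul, zero_mul, Finset.sum_ite_irrel, Finset.sum_const_zero,
    Finset.sum_ite_eq, Finset.mem_univ, if_true]
  refine Finset.sum_congr rfl fun l _ => ?_
  simp only [Finset.sum_comm (s := (Finset.univ : Finset P)) (t := (Finset.univ : Finset L))]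
  refine Finset.sum_congr rfl fun l' _ => ?_
  rw [Finset.sum_comm]
  refine Finset.sum_congr rfl fun q _ => ?_
  conv_rhs => rw [Finset.sum_comm]
  refine Finset.sum_congr rfl fun p _ => ?_
  rw [Finset.sum_comm]

theorem codeFidelity_eq (N : Matrix P P ℂ →ₗ[ℂ] Matrix P P ℂ) (E : Matrix L L ℂ →ₗ[ℂ] Matrix P P ℂ)
    (D : Matrix P P ℂ →ₗ[ℂ] Matrix L L ℂ) :
    codeFidelity N E D = ((((Fintype.card L : ℂ)⁻¹) ^ 2) * ∑ l, ∑ l', ∑ q, ∑ q', ∑ p, ∑ p',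
      E (single l l' 1) q q' * N (single q q' 1) p p' * D (single p p' 1) l l').re := by
  have h1 : ∀ l l' : L, (of fun x y => maxEntangled L (l, x) (l', y)) =
      (Fintype.card L : ℂ)⁻¹ • single l l' (1 : ℂ) := by
    intro l l'
    ext x y
    simp [maxEntangled, single_apply]
  have h2 : ∀ l l' : L, (D ∘ₗ N ∘ₗ E) (single l l' 1) l l' = ∑ q, ∑ q', ∑ p, ∑ p',
      E (single l l' 1) q q' * N (single q q' 1) p p' * D (single p p' 1) l l' := by
    intro l l'
    have h3 : (D ∘ₗ N ∘ₗ E) (single l l' 1) l l' = D (N (E (single l l' 1))) l l' := rfl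
    have h4 : ∀ q q', D (N (single q q' 1)) l l' =
        ∑ p, ∑ p', N (single q q' 1) p p' * D (single p p' 1) l l' := fun q q' =>
      map_apply_eq_sum D _ l l'
    have h5 := map_apply_eq_sum (D ∘ₗ N) (E (single l l' 1)) l l'
    simp only [LinearMap.comp_apply, h4, Finset.mul_sum] at h5
    simp only [h3, h5, mul_assoc]
  rw [codeFidelity]
  congr 1
  simp only [← h2, Matrix.trace, diag_apply, mul_apply, idTensor, LinearMap.coe_mk, AddHom.coe_mk,
    of_apply, h1, map_smul, Matrix.smul_apply, smul_eq_mul]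
  simp only [maxEntangled, of_apply, Fintype.sum_prod_type, ite_and, ite_mul, zero_mul,
    Finset.sum_ite_irrel, Finset.sum_const_zero, Finset.sum_ite_eq, Finset.mem_univ, if_true]
  rw [Finset.sum_comm, Finset.mul_sum]
  refine Finset.sum_congr rfl fun l _ => ?_
  rw [Finset.mul_sum]
  exact Finset.sum_congr rfl fun l' _ => by ring

theorem objective_choi [Nonempty P] (N : Matrix P P ℂ →ₗ[ℂ] Matrix P P ℂ)
    (E : Matrix L L ℂ →ₗ[ℂ] Matrix P P ℂ) (D : Matrix P P ℂ →ₗ[ℂ] Matrix L L ℂ) :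
    objective N ((choi D)ᵀ ⊗ₖ (choi E)ᵀ.submatrix Prod.swap Prod.swap) = codeFidelity N E D := by
  have hP : (Fintype.card P : ℂ) ≠ 0 := by exact_mod_cast Fintype.card_ne_zero
  rw [codeFidelity_eq, objective, trace_choiIdTensor_mul_kronecker]
  rw [← Complex.re_ofReal_mul]
  congr 1
  simp only [Finset.mul_sum, transpose_apply, submatrix_apply, Prod.swap_prod_mk, choi, of_apply]
  refine Finset.sum_congr rfl fun l _ => Finset.sum_congr rfl fun l' _ =>
    Finset.sum_congr rfl fun q _ => Finset.sum_congr rfl fun q' _ =>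
    Finset.sum_congr rfl fun p _ => Finset.sum_congr rfl fun p' _ => ?_
  push_cast
  field_simp

/-! ### The channel fidelity between the inner and the outer bounds -/

section Fidelity

variable {dL dP : ℕ}

theorem trace_eq_one_of_trFst {a b : Type} [Fintype a] [Fintype b] [DecidableEq b] [Nonempty b]
    {X : Matrix (a × b) (a × b) ℂ} (h : trFst X = maxMixed b) : X.trace = 1 := by
  rw [← trace_trFst, h, trace_maxMixed]

theorem transpose_maxMixed (a : Type) [Fintype a] [DecidableEq a] :
    (maxMixed a)ᵀ = maxMixed a := by
  simp [maxMixed]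

theorem posSemidef_maxMixed (a : Type) [Fintype a] [DecidableEq a] :
    (maxMixed a).PosSemidef :=
  PosSemidef.one.smul (inv_nonneg.2 (Nat.cast_nonneg' _))

theorem trFst_maxMixed (a b : Type) [Fintype a] [DecidableEq a] [Nonempty a] [Fintype b]
    [DecidableEq b] : trFst (maxMixed (a × b)) = maxMixed b := by
  have hn : (Fintype.card a : ℂ) ≠ 0 := by exact_mod_cast Fintype.card_ne_zero
  ext i j
  by_cases hij : i = j
  · subst hij
    simp [trFst, maxMixed]
    field_simp
  · simp [trFst, maxMixed, one_apply, hij]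

theorem codeFidelity_le_of_isOptimizer [NeZero dL] [NeZero dP]
    {N : Matrix (Fin dP) (Fin dP) ℂ →ₗ[ℂ] Matrix (Fin dP) (Fin dP) ℂ} {k : ℕ}
    {ρ : ExtOp (Fin dL) (Fin dP) (k + 1)} (hρ : IsOptimizer N ρ)
    {E : Matrix (Fin dL) (Fin dL) ℂ →ₗ[ℂ] Matrix (Fin dP) (Fin dP) ℂ}
    {D : Matrix (Fin dP) (Fin dP) ℂ →ₗ[ℂ] Matrix (Fin dL) (Fin dL) ℂ}
    (hE : IsChannel E) (hD : IsChannel D) : codeFidelity N E D ≤ objective N (reduced ρ) := by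
  have hE1 := trFst_choi hE
  have hD1 := trFst_choi hD
  rw [← objective_choi]
  refine hρ.2 _ (kronecker_mem_SigmaProdLevel ⟨(posSemidef_choi hD).transpose, ?_⟩
    ⟨(posSemidef_choi hE).transpose.submatrix _, ?_⟩ ?_ ?_ k)
  · rw [trace_transpose, trace_eq_one_of_trFst hD1]
  · rw [← trace_trSnd]
    have : trSnd ((choi E)ᵀ.submatrix Prod.swap Prod.swap) = (trFst (choi E))ᵀ := rfl
    rw [this, trace_transpose, trace_trFst, trace_eq_one_of_trFst hE1]
  · have : trFst (choi D)ᵀ = (trFst (choi D))ᵀ := rfl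
    rw [this, hD1, transpose_maxMixed]
  · have : trSnd ((choi E)ᵀ.submatrix Prod.swap Prod.swap) = (trFst (choi E))ᵀ := rfl
    rw [this, hE1, transpose_maxMixed]

/-- A product state in `Σ_prod` is, up to transposition, the pair of the Choi matrices of a decoder
and an encoder. -/
theorem exists_codeFidelity_eq [NeZero dL] [NeZero dP]
    (N : Matrix (Fin dP) (Fin dP) ℂ →ₗ[ℂ] Matrix (Fin dP) (Fin dP) ℂ)
    {ρ σ : Matrix (Fin dL × Fin dP) (Fin dL × Fin dP) ℂ} (hρ : IsState ρ) (hσ : IsState σ)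
    (hρP : trFst ρ = maxMixed (Fin dP)) (hσL : trSnd σ = maxMixed (Fin dL)) :
    ∃ (E : Matrix (Fin dL) (Fin dL) ℂ →ₗ[ℂ] Matrix (Fin dP) (Fin dP) ℂ)
      (D : Matrix (Fin dP) (Fin dP) ℂ →ₗ[ℂ] Matrix (Fin dL) (Fin dL) ℂ),
      IsChannel E ∧ IsChannel D ∧ objective N (ρ ⊗ₖ σ) = codeFidelity N E D := by
  refine ⟨ofChoi (σᵀ.submatrix Prod.swap Prod.swap), ofChoi ρᵀ,
    isChannel_ofChoi (hσ.1.transpose.submatrix _) ?_, isChannel_ofChoi hρ.1.transpose ?_, ?_⟩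
  · have : trFst (σᵀ.submatrix Prod.swap Prod.swap) = (trSnd σ)ᵀ := rfl
    rw [this, hσL, transpose_maxMixed]
  · have : trFst ρᵀ = (trFst ρ)ᵀ := rfl
    rw [this, hρP, transpose_maxMixed]
  · rw [← objective_choi, choi_ofChoi, choi_ofChoi]
    rfl

theorem objective_le_channelFidelity [NeZero dL] [NeZero dP]
    {N : Matrix (Fin dP) (Fin dP) ℂ →ₗ[ℂ] Matrix (Fin dP) (Fin dP) ℂ} {k : ℕ}
    {ρ : ExtOp (Fin dL) (Fin dP) (k + 1)} (hρ : IsOptimizer N ρ)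
    {ω : Matrix ((Fin dL × Fin dP) × (Fin dL × Fin dP)) ((Fin dL × Fin dP) × (Fin dL × Fin dP)) ℂ}
    (hω : ω ∈ SigmaProd (Fin dL) (Fin dP)) : objective N ω ≤ channelFidelity (Fin dL) N := by
  have hbdd : BddAbove {f : ℝ | ∃ (E : Matrix (Fin dL) (Fin dL) ℂ →ₗ[ℂ] Matrix (Fin dP) (Fin dP) ℂ)
      (D : Matrix (Fin dP) (Fin dP) ℂ →ₗ[ℂ] Matrix (Fin dL) (Fin dL) ℂ),
      IsChannel E ∧ IsChannel D ∧ f = codeFidelity N E D} :=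
    ⟨objective N (reduced ρ), by
      rintro f ⟨E, D, hE, hD, rfl⟩
      exact codeFidelity_le_of_isOptimizer hρ hE hD⟩
  have hconv : Convex ℝ {ω : Matrix ((Fin dL × Fin dP) × (Fin dL × Fin dP))
      ((Fin dL × Fin dP) × (Fin dL × Fin dP)) ℂ |
        objective N ω ≤ channelFidelity (Fin dL) N} := by
    refine convex_halfSpace_le (f := objective N) ⟨fun x y => ?_, fun c x => ?_⟩ _
    · simp [objective, trace_add, mul_add]
    · simp only [objective, Matrix.mul_smul, trace_smul, Complex.smul_re, smul_eq_mul]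
      ring
  refine convexHull_min ?_ hconv hω
  rintro _ ⟨ρ', σ', hρ', hσ', hρP, hσL, rfl⟩
  obtain ⟨E, D, hE, hD, h⟩ := exists_codeFidelity_eq N hρ' hσ' hρP hσL
  exact le_csSup hbdd ⟨E, D, hE, hD, h⟩

theorem channelFidelity_le_of_isOptimizer [NeZero dL] [NeZero dP]
    {N : Matrix (Fin dP) (Fin dP) ℂ →ₗ[ℂ] Matrix (Fin dP) (Fin dP) ℂ} {k : ℕ}
    {ρ : ExtOp (Fin dL) (Fin dP) (k + 1)} (hρ : IsOptimizer N ρ) :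
    channelFidelity (Fin dL) N ≤ objective N (reduced ρ) := by
  refine csSup_le ?_ ?_
  · -- the completely depolarizing encoder and decoder
    have hL : IsChannel (ofChoi (a := Fin dL) (b := Fin dP)
        (maxMixed (Fin dP × Fin dL))) := by
      refine isChannel_ofChoi ?_ ?_
      · exact posSemidef_maxMixed _
      · exact trFst_maxMixed _ _
    have hP : IsChannel (ofChoi (a := Fin dP) (b := Fin dL)
        (maxMixed (Fin dL × Fin dP))) := by
      refine isChannel_ofChoi ?_ ?_
      · exact posSemidef_maxMixed _
      · exact trFst_maxMixed _ _
    exact ⟨_, _, _, hL, hP, rfl⟩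
  · rintro f ⟨E, D, hE, hD, rfl⟩
    exact codeFidelity_le_of_isOptimizer hρ hE hD

end Fidelity

/-! ### An informationally complete measurement with polynomial distortion -/

section Polarization

variable {a b : Type} [Fintype a] [DecidableEq a] [Fintype b] [DecidableEq b]

/-- The vector `|x⟩ + Iᵗ |y⟩`, where `z = (x, y, t)` and `I` is the imaginary unit. -/
def polVec (z : b × b × Fin 4) : b → ℂ :=
  Pi.single z.1 1 + (Complex.I ^ (z.2.2 : ℕ)) • Pi.single z.2.1 1

/-- The measurement with effects proportional to the projectors onto `|x⟩ + Iᵗ |y⟩`. -/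
noncomputable def polMeas (b : Type) [Fintype b] [DecidableEq b] (z : b × b × Fin 4) :
    Matrix b b ℂ :=
  ((8 * Fintype.card b : ℝ)⁻¹) • vecMulVec (polVec z) (star (polVec z))

theorem posSemidef_polMeas (z : b × b × Fin 4) : (polMeas b z).PosSemidef :=
  (posSemidef_vecMulVec_self_star _).smul (by positivity)

theorem vecMulVec_polVec_apply (i j : b) (t : Fin 4) (x y : b) :
    vecMulVec (polVec (i, j, t)) (star (polVec (i, j, t))) x y =
      ((Pi.single i 1 : b → ℂ) x + Complex.I ^ (t : ℕ) * (Pi.single j 1 : b → ℂ) x) *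
        ((Pi.single i 1 : b → ℂ) y + (-Complex.I) ^ (t : ℕ) * (Pi.single j 1 : b → ℂ) y) := by
  have h : ∀ i y : b, star ((Pi.single i 1 : b → ℂ) y) = (Pi.single i 1 : b → ℂ) y := by
    intro i y
    rw [Pi.single_apply]
    split_ifs <;> simp
  simp only [vecMulVec_apply, polVec, Pi.add_apply, Pi.star_apply, Pi.smul_apply, smul_eq_mul,
    star_add, star_mul', star_pow, h, RCLike.star_def, Complex.conj_I]

theorem single_one_apply (i j x y : b) :
    single i j (1 : ℂ) x y = (Pi.single i 1 : b → ℂ) x * (Pi.single j 1 : b → ℂ) y := by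
  simp only [single_apply, Pi.single_apply, eq_comm (a := i), eq_comm (a := j), ite_and, ite_mul,
    one_mul, zero_mul]

theorem sum_vecMulVec_polVec (i j : b) :
    ∑ t, vecMulVec (polVec (i, j, t)) (star (polVec (i, j, t))) =
      (4 : ℂ) • (single i i 1 + single j j 1) := by
  ext x y
  simp only [Matrix.sum_apply, vecMulVec_polVec_apply, Matrix.smul_apply, Matrix.add_apply,
    single_one_apply, Fin.sum_univ_four, smul_eq_mul, Fin.val_zero, Fin.val_one, Fin.val_two,
    show ((3 : Fin 4) : ℕ) = 3 from rfl, pow_zero, pow_one, Complex.I_sq, Complex.I_pow_three,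
    neg_sq, Odd.neg_pow (⟨1, rfl⟩ : Odd 3)]
  linear_combination (-2 * (Pi.single j 1 : b → ℂ) x * (Pi.single j 1 : b → ℂ) y) * Complex.I_sq

/-- The polarization identity for `|i⟩⟨j|`. -/
theorem sum_smul_vecMulVec_polVec (i j : b) :
    ∑ t : Fin 4, Complex.I ^ (t : ℕ) • vecMulVec (polVec (i, j, t)) (star (polVec (i, j, t))) =
      (4 : ℂ) • single i j 1 := by
  ext x y
  simp only [Matrix.sum_apply, vecMulVec_polVec_apply, Matrix.smul_apply,
    single_one_apply, Fin.sum_univ_four, smul_eq_mul, Fin.val_zero, Fin.val_one, Fin.val_two,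
    show ((3 : Fin 4) : ℕ) = 3 from rfl, pow_zero, pow_one, Complex.I_sq, Complex.I_pow_three,
    neg_sq, Odd.neg_pow (⟨1, rfl⟩ : Odd 3)]
  linear_combination (-2 * (Pi.single i 1 : b → ℂ) x * (Pi.single j 1 : b → ℂ) y +
    2 * (Pi.single j 1 : b → ℂ) x * (Pi.single i 1 : b → ℂ) y) * Complex.I_sq

theorem sum_polMeas [Nonempty b] : ∑ z, polMeas b z = 1 := by
  have hn : (Fintype.card b : ℂ) ≠ 0 := by exact_mod_cast Fintype.card_ne_zero
  have h2 : ∑ i : b, single i i (1 : ℂ) = 1 := by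
    ext x y
    simp [Matrix.sum_apply, single_apply, one_apply, ite_and]
  simp only [polMeas, ← Finset.smul_sum, Fintype.sum_prod_type, sum_vecMulVec_polVec,
    Finset.sum_add_distrib, h2, Finset.sum_const, Finset.card_univ, ← Nat.cast_smul_eq_nsmul ℂ]
  ext x y
  simp only [Matrix.smul_apply, Matrix.add_apply, smul_eq_mul, Complex.real_smul]
  push_cast
  field_simp
  ring

theorem single_eq_sum_polMeas [Nonempty b] (i j : b) :
    single i j (1 : ℂ) =
      ∑ t : Fin 4, (2 * (Fintype.card b : ℂ) * Complex.I ^ (t : ℕ)) • polMeas b (i, j, t) := by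
  have hn : (Fintype.card b : ℂ) ≠ 0 := by exact_mod_cast Fintype.card_ne_zero
  have h := sum_smul_vecMulVec_polVec i j
  have h4 : single i j (1 : ℂ) = (4 : ℂ)⁻¹ • ∑ t : Fin 4,
      Complex.I ^ (t : ℕ) • vecMulVec (polVec (i, j, t)) (star (polVec (i, j, t))) := by
    rw [h, smul_smul, inv_mul_cancel₀ (by norm_num), one_smul]
  rw [h4, Finset.smul_sum]
  refine Finset.sum_congr rfl fun t _ => ?_
  ext x y
  simp only [polMeas, Matrix.smul_apply, smul_eq_mul, Complex.real_smul]
  push_cast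
  field_simp
  ring

open scoped Matrix.Norms.L2Operator in
/-- A block of an operator on a tensor product has at most its norm. -/
theorem opNorm_submatrix_le (U : Matrix (a × b) (a × b) ℂ) (i j : b) :
    opNorm (U.submatrix (fun x => (x, j)) (fun x => (x, i))) ≤ opNorm U := by
  have hV : ∀ i : b, ‖(1 : Matrix (a × b) (a × b) ℂ).submatrix id (fun x : a => (x, i))‖ ≤ 1 := by
    intro i
    have h := Matrix.l2_opNorm_conjTranspose_mul_self
      ((1 : Matrix (a × b) (a × b) ℂ).submatrix id (fun x : a => (x, i)))
    have h1 : ((1 : Matrix (a × b) (a × b) ℂ).submatrix id (fun x : a => (x, i)))ᴴ *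
        (1 : Matrix (a × b) (a × b) ℂ).submatrix id (fun x : a => (x, i)) = 1 := by
      ext x y
      simp [mul_apply, one_apply, eq_comm]
    rw [h1, ← opNorm_eq_norm] at h
    nlinarith [opNorm_one_le (a := a), norm_nonneg
      ((1 : Matrix (a × b) (a × b) ℂ).submatrix id (fun x : a => (x, i)))]
  have h : U.submatrix (fun x => (x, j)) (fun x => (x, i)) =
      ((1 : Matrix (a × b) (a × b) ℂ).submatrix id (fun x : a => (x, j)))ᴴ * U *
        (1 : Matrix (a × b) (a × b) ℂ).submatrix id (fun x : a => (x, i)) := by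
    ext x y
    simp [mul_apply, one_apply]
  rw [opNorm_eq_norm, opNorm_eq_norm, h]
  refine (Matrix.l2_opNorm_mul _ _).trans ?_
  refine (mul_le_of_le_one_right (norm_nonneg _) (hV i)).trans ?_
  refine (Matrix.l2_opNorm_mul _ _).trans ?_
  rw [Matrix.l2_opNorm_conjTranspose]
  exact mul_le_of_le_one_left (norm_nonneg _) (hV j)

theorem isHermitian_partialContract {W : Matrix b b ℂ} (hW : W.IsHermitian)
    {X : Matrix (a × b) (a × b) ℂ} (hX : X.IsHermitian) : (partialContract W X).IsHermitian := by
  ext i j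
  simp only [partialContract, conjTranspose_apply, of_apply, star_sum, star_mul', hW.apply,
    hX.apply]
  exact Finset.sum_comm

theorem partialContract_smul_left (W : Matrix b b ℂ) (c : ℂ) (X : Matrix (a × b) (a × b) ℂ) :
    partialContract (c • W) X = c • partialContract W X := by
  ext i j
  simp only [partialContract, of_apply, Matrix.smul_apply, smul_eq_mul, Finset.mul_sum, mul_assoc]

/-- Every block of a Hermitian operator is recovered from the measured blocks by polarization. -/
theorem traceNorm_le_sum_polMeas [Nonempty b] {ζ : Matrix (a × b) (a × b) ℂ}
    (hζ : ζ.IsHermitian) :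
    traceNorm ζ ≤ 2 * (Fintype.card b : ℝ) * ∑ z, traceNorm (partialContract (polMeas b z) ζ) := by
  obtain ⟨U, hU, -, htr⟩ := exists_unitary_trace_mul_eq hζ
  have hU1 := opNorm_le_one_of_conjTranspose_mul_self hU
  have hblocks : (U * ζ).trace = ∑ i, ∑ j, (U.submatrix (fun x => (x, i)) (fun x => (x, j)) *
      partialContract (single i j 1) ζ).trace := by
    simp only [Matrix.trace, diag_apply, mul_apply, submatrix_apply, partialContract, of_apply,
      Fintype.sum_prod_type, single_apply, ite_and, ite_mul, one_mul, zero_mul,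
      Finset.sum_ite_irrel, Finset.sum_const_zero, Finset.sum_ite_eq, Finset.mem_univ, if_true]
    rw [Finset.sum_comm]
    refine Finset.sum_congr rfl fun i _ => ?_
    rw [Finset.sum_comm' (t' := Finset.univ) (s' := fun _ => Finset.univ) (by simp)]
    conv_rhs => rw [Finset.sum_comm]
    rw [Finset.sum_comm]
    refine Finset.sum_congr rfl fun x _ => ?_
    exact Finset.sum_comm
  have hterm : ∀ i j, ‖(U.submatrix (fun x => (x, i)) (fun x => (x, j)) *
      partialContract (single i j 1) ζ).trace‖ ≤ 2 * (Fintype.card b : ℝ) *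
        ∑ t, traceNorm (partialContract (polMeas b (i, j, t)) ζ) := by
    intro i j
    rw [single_eq_sum_polMeas, partialContract_sum, Finset.mul_sum, trace_sum, Finset.mul_sum]
    refine (norm_sum_le _ _).trans (Finset.sum_le_sum fun t _ => ?_)
    rw [partialContract_smul_left, Matrix.mul_smul, trace_smul, smul_eq_mul, norm_mul]
    have h1 : ‖2 * (Fintype.card b : ℂ) * Complex.I ^ (t : ℕ)‖ = 2 * (Fintype.card b : ℝ) := by
      simp
    rw [h1]
    refine mul_le_mul_of_nonneg_left ?_ (by positivity)
    refine (norm_trace_mul_le _ (isHermitian_partialContract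
      (posSemidef_polMeas _).isHermitian hζ)).trans ?_
    exact mul_le_of_le_one_left (traceNorm_nonneg _) ((opNorm_submatrix_le _ _ _).trans hU1)
  have h0 : traceNorm ζ = ‖(U * ζ).trace‖ := by
    rw [htr, Complex.norm_real, Real.norm_of_nonneg (traceNorm_nonneg _)]
  rw [h0, hblocks, Fintype.sum_prod_type, Finset.mul_sum]
  refine (norm_sum_le _ _).trans (Finset.sum_le_sum fun i _ => ?_)
  rw [Fintype.sum_prod_type, Finset.mul_sum]
  exact (norm_sum_le _ _).trans (Finset.sum_le_sum fun j _ => hterm i j)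

end Polarization

theorem trace_maxEntangled (a : Type) [Fintype a] [DecidableEq a] [Nonempty a] :
    (maxEntangled a).trace = 1 := by
  have hn : (Fintype.card a : ℂ) ≠ 0 := by exact_mod_cast Fintype.card_ne_zero
  simp [Matrix.trace, maxEntangled, Fintype.sum_prod_type, hn]

/-- The Choi matrix of a channel is a state. -/
theorem opNorm_choiIdTensor_le_one {L : Type} [Fintype L] [DecidableEq L] [Nonempty L] {n : ℕ}
    [NeZero n] {N : Matrix (Fin n) (Fin n) ℂ →ₗ[ℂ] Matrix (Fin n) (Fin n) ℂ} (hN : IsChannel N) :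
    opNorm (choiIdTensor L N) ≤ 1 := by
  have h : choiIdTensor L N = (maxEntangled L ⊗ₖ choi N).submatrix
      (Equiv.prodProdProdComm L (Fin n) L (Fin n))
      (Equiv.prodProdProdComm L (Fin n) L (Fin n)) := by
    ext i j
    rw [choiIdTensor_apply]
    simp only [submatrix_apply, kroneckerMap_apply, maxEntangled, choi, of_apply,
      Equiv.prodProdProdComm_apply, ite_and, mul_inv]
    split_ifs <;> ring
  have hpos : (choiIdTensor L N).PosSemidef := by
    rw [h]
    exact ((posSemidef_maxEntangled L).kronecker (posSemidef_choi hN)).submatrix _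
  have htr : (choiIdTensor L N).trace = 1 := by
    have h1 : ((maxEntangled L ⊗ₖ choi N).submatrix (Equiv.prodProdProdComm L (Fin n) L (Fin n))
        (Equiv.prodProdProdComm L (Fin n) L (Fin n))).trace = (maxEntangled L ⊗ₖ choi N).trace :=
      Equiv.sum_comp (Equiv.prodProdProdComm L (Fin n) L (Fin n))
        fun i => (maxEntangled L ⊗ₖ choi N) i i
    rw [h, h1, trace_kronecker, trace_maxEntangled, trace_eq_one_of_trFst (trFst_choi hN), one_mul]
  simpa [htr] using opNorm_le_trace hpos

theorem exists_isInfoComplete (dL dP : ℕ) [NeZero dL] [NeZero dP] :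
    ∃ (s : ℕ) (M : Fin s → Matrix (Fin dL × Fin dP) (Fin dL × Fin dP) ℂ),
      IsMeasurement M ∧ IsInfoComplete M (2 * ((dL : ℝ) * dP)) := by
  let e := (Fintype.equivFin ((Fin dL × Fin dP) × (Fin dL × Fin dP) × Fin 4)).symm
  refine ⟨_, fun s => polMeas (Fin dL × Fin dP) (e s), ⟨fun s => posSemidef_polMeas _, ?_⟩,
    fun ζ hζ => ?_⟩
  · rw [Equiv.sum_comp e (polMeas (Fin dL × Fin dP)), sum_polMeas]
  · simp only [measuredBlock_eq_partialContract]
    rw [Equiv.sum_comp e fun z => traceNorm (partialContract (polMeas (Fin dL × Fin dP) z) ζ)]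
    simpa using traceNorm_le_sum_polMeas hζ

/-! ### The inner bounds -/

/-- For the distortion `2 d` the error is at most `4 d_L² d_P⁴ / √n`, from `d_P² · ‖C‖_∞ · c · √(2 ln d)` with
`‖C‖_∞ ≤ 1`, `c = 2 d` and `2 ln d ≤ (2 d)²`. -/
theorem errorBound_le_poly {dL dP : ℕ} [NeZero dL] [NeZero dP]
    {N : Matrix (Fin dP) (Fin dP) ℂ →ₗ[ℂ] Matrix (Fin dP) (Fin dP) ℂ} (hN : IsChannel N) (k : ℕ) :
    (dP : ℝ) ^ 2 * opNorm (choiIdTensor (Fin dL) N) * (2 * ((dL : ℝ) * dP)) *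
        Real.sqrt (2 * Real.log ((dL : ℝ) * dP) / ((k : ℝ) + 1)) ≤
      4 * (dL : ℝ) ^ 2 * (dP : ℝ) ^ 4 / Real.sqrt ((k : ℝ) + 1) := by
  have hL : (0 : ℝ) < dL := Nat.cast_pos.2 (NeZero.pos dL)
  have hP : (0 : ℝ) < dP := Nat.cast_pos.2 (NeZero.pos dP)
  have hsqrt : Real.sqrt (2 * Real.log ((dL : ℝ) * dP)) ≤ 2 * ((dL : ℝ) * dP) := by
    have h1 := Real.log_le_sub_one_of_pos (mul_pos hL hP)
    refine Real.sqrt_le_iff.2 ⟨by positivity, ?_⟩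
    -- `2 ln x ≤ 2 (x - 1) ≤ (2 x)²`
    nlinarith [sq_nonneg ((dL : ℝ) * dP - 1 / 4)]
  rw [Real.sqrt_div' _ (by positivity), mul_div_assoc']
  refine div_le_div_of_nonneg_right ?_ (Real.sqrt_nonneg _)
  calc (dP : ℝ) ^ 2 * opNorm (choiIdTensor (Fin dL) N) * (2 * ((dL : ℝ) * dP)) *
        Real.sqrt (2 * Real.log ((dL : ℝ) * dP))
      ≤ (dP : ℝ) ^ 2 * 1 * (2 * ((dL : ℝ) * dP)) * (2 * ((dL : ℝ) * dP)) := by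
        gcongr
        · exact opNorm_choiIdTensor_le_one hN
    _ = 4 * (dL : ℝ) ^ 2 * (dP : ℝ) ^ 4 := by ring

theorem exists_inner_bound {dL dP : ℕ} [NeZero dL] [NeZero dP]
    (N : Matrix (Fin dP) (Fin dP) ℂ →ₗ[ℂ] Matrix (Fin dP) (Fin dP) ℂ) {Z : Type} [Fintype Z]
    {M : Z → Matrix (Fin dL × Fin dP) (Fin dL × Fin dP) ℂ} {c : ℝ} (hM : IsMeasurement M)
    (hc : IsInfoComplete M c) {k : ℕ} {ρ : ExtOp (Fin dL) (Fin dP) (k + 1)}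
    (hρ : IsOptimizer N ρ) :
    ∃ m ≤ k, rounded M ρ m ∈ SigmaProd (Fin dL) (Fin dP) ∧
      objective N (rounded M ρ m) ≤ channelFidelity (Fin dL) N ∧
      channelFidelity (Fin dL) N ≤ objective N (reduced ρ) ∧
      objective N (reduced ρ) - objective N (rounded M ρ m) ≤
        (dP : ℝ) ^ 2 * opNorm (choiIdTensor (Fin dL) N) * c *
          Real.sqrt (2 * Real.log ((dL : ℝ) * dP) / ((k : ℝ) + 1)) := by
  obtain ⟨m, hm, h⟩ := exists_objective_reduced_sub_rounded_le hM hc N hρ.1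
  have hmem := rounded_mem_SigmaProd hM hρ.1 hm
  refine ⟨m, hm, hmem, objective_le_channelFidelity hρ hmem, channelFidelity_le_of_isOptimizer hρ,
    ?_⟩
  simpa using h

end AQEC

/-- The level of the hierarchy is `n = k + 1`, and `m k ≤ k` is the number of measured extension
systems at that level. The first part is the bound for an arbitrary informationally complete
measurement, with distortion `c`; the second one the bound `poly(d_L, d_P) / √n`, for a suitable
measurement that depends only on the dimensions. -/
theorem theorem3p1 :
    (∀ (dL dP : ℕ), 0 < dL → 0 < dP →
      ∀ (N : Matrix (Fin dP) (Fin dP) ℂ →ₗ[ℂ] Matrix (Fin dP) (Fin dP) ℂ), AQEC.IsChannel N →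
      ∀ (Z : Type) [Fintype Z] (M : Z → Matrix (Fin dL × Fin dP) (Fin dL × Fin dP) ℂ) (c : ℝ),
        AQEC.IsMeasurement M → AQEC.IsInfoComplete M c →
      ∀ (ρ : (k : ℕ) → AQEC.ExtOp (Fin dL) (Fin dP) (k + 1)),
        (∀ k, AQEC.IsOptimizer N (ρ k)) →
      ∃ m : ℕ → ℕ,
        (∀ k : ℕ,
          let σ := AQEC.rounded M (ρ k) (m k)
          let F := AQEC.channelFidelity (Fin dL) N
          let ε := (dP : ℝ) ^ 2 * AQEC.opNorm (AQEC.choiIdTensor (Fin dL) N) * c *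
            Real.sqrt (2 * Real.log ((dL : ℝ) * dP) / ((k : ℝ) + 1))
          m k ≤ k ∧
          σ ∈ AQEC.SigmaProd (Fin dL) (Fin dP) ∧
          0 ≤ F - AQEC.objective N σ ∧ F - AQEC.objective N σ ≤ ε ∧
          0 ≤ AQEC.objective N (AQEC.reduced (ρ k)) - F ∧
          AQEC.objective N (AQEC.reduced (ρ k)) - AQEC.objective N σ ≤ ε) ∧
        Tendsto (fun k => AQEC.objective N (AQEC.rounded M (ρ k) (m k))) atTop
          (𝓝 (AQEC.channelFidelity (Fin dL) N))) ∧
    (∃ poly : MvPolynomial (Fin 2) ℝ,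
      ∀ (dL dP : ℕ), 0 < dL → 0 < dP →
      ∃ (s : ℕ) (M : Fin s → Matrix (Fin dL × Fin dP) (Fin dL × Fin dP) ℂ) (c : ℝ),
        AQEC.IsMeasurement M ∧ AQEC.IsInfoComplete M c ∧
        ∀ (N : Matrix (Fin dP) (Fin dP) ℂ →ₗ[ℂ] Matrix (Fin dP) (Fin dP) ℂ), AQEC.IsChannel N →
        ∀ (ρ : (k : ℕ) → AQEC.ExtOp (Fin dL) (Fin dP) (k + 1)),
          (∀ k, AQEC.IsOptimizer N (ρ k)) →
        ∃ m : ℕ → ℕ, ∀ k : ℕ,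
          let σ := AQEC.rounded M (ρ k) (m k)
          let F := AQEC.channelFidelity (Fin dL) N
          m k ≤ k ∧
          σ ∈ AQEC.SigmaProd (Fin dL) (Fin dP) ∧
          0 ≤ F - AQEC.objective N σ ∧
          F - AQEC.objective N σ ≤
            MvPolynomial.eval ![(dL : ℝ), (dP : ℝ)] poly / Real.sqrt ((k : ℝ) + 1)) := by
  refine ⟨?_, MvPolynomial.C 4 * MvPolynomial.X 0 ^ 2 * MvPolynomial.X 1 ^ 4, ?_⟩
  · intro dL dP hdL hdP N _ Z _ M c hM hc ρ hρ
    have : NeZero dL := ⟨hdL.ne'⟩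
    have : NeZero dP := ⟨hdP.ne'⟩
    choose m hm hmem hlow hup hgap using fun k => AQEC.exists_inner_bound N hM hc (hρ k)
    refine ⟨m, fun k => ⟨hm k, hmem k, by linarith [hlow k], by linarith [hup k, hgap k],
      by linarith [hup k], hgap k⟩, ?_⟩
    have hlim : Tendsto (fun k : ℕ => AQEC.channelFidelity (Fin dL) N -
        (dP : ℝ) ^ 2 * AQEC.opNorm (AQEC.choiIdTensor (Fin dL) N) * c *
          Real.sqrt (2 * Real.log ((dL : ℝ) * dP) / ((k : ℝ) + 1))) atTop
        (𝓝 (AQEC.channelFidelity (Fin dL) N)) := by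
      have h1 : Tendsto (fun k : ℕ => 2 * Real.log ((dL : ℝ) * dP) / ((k : ℝ) + 1)) atTop (𝓝 0) :=
        tendsto_const_nhds.div_atTop
          (tendsto_atTop_add_const_right _ _ tendsto_natCast_atTop_atTop)
      have h2 := h1.sqrt
      rw [Real.sqrt_zero] at h2
      simpa using (h2.const_mul ((dP : ℝ) ^ 2 *
        AQEC.opNorm (AQEC.choiIdTensor (Fin dL) N) * c)).const_sub
          (AQEC.channelFidelity (Fin dL) N)
    exact tendsto_of_tendsto_of_tendsto_of_le_of_le hlim tendsto_const_nhds
      (fun k => by linarith [hup k, hgap k]) hlow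
  · intro dL dP hdL hdP
    have : NeZero dL := ⟨hdL.ne'⟩
    have : NeZero dP := ⟨hdP.ne'⟩
    obtain ⟨s, M, hM, hc⟩ := AQEC.exists_isInfoComplete dL dP
    refine ⟨s, M, _, hM, hc, fun N hN ρ hρ => ?_⟩
    choose m hm hmem hlow hup hgap using fun k => AQEC.exists_inner_bound N hM hc (hρ k)
    refine ⟨m, fun k => ⟨hm k, hmem k, by linarith [hlow k], ?_⟩⟩
    have h1 := AQEC.errorBound_le_poly (dL := dL) hN k
    simp only [map_mul, map_pow, MvPolynomial.eval_C, MvPolynomial.eval_X, Matrix.cons_val_zero,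
      Matrix.cons_val_one]
    linarith [hup k, hgap k]
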